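/- All semirings are commutative with $0$ and $1$. A semiring scheme $(X,\mathcal O_X)$ is a topological space with a sheaf of semirings that is locally isomorphic to prime spectra $(\operatorname{Spec} R,\mathcal O_{\operatorname{Spec} R})$ of semirings $R$, where a section of $\mathcal O_{\operatorname{Spec} R}$ over $U$ is a function $s$ on $U$ with $s(\mathfrak p)\in R_{\mathfrak p}$ that is locally a fraction of elements of $R$. A sheaf $\mathcal L$ of $\mathcal O_X$-semimodules is invertible if it is locally isomorphic to $\mathcal O_X$. For sheaves of $\mathcal O_X$-semimodules $\mathcal F,\mathcal G$, let $\mathcal F\otimes_{\mathcal O_X}\mathcal G$ be the sheafification of $U\mapsto \mathcal F(U)\otimes_{\mathcal O_X(U)}\mathcal G(U)$, where $\otimes$ is the tensor product of semimodules that represents bilinear maps (Pareigis–Röhrl). Let $\operatorname{Pic}(X)$ be the set of isomorphism classes of invertible sheaves of $\mathcal O_X$-semimodules, with the product $[\mathcal L][\mathcal M]=[\mathcal L\otimes_{\mathcal O_X}\mathcal M]$. Let $\mathcal O_X^*$ be the sheaf of abelian groups $U\mapsto \mathcal O_X(U)^\times$, written multiplicatively. For an open covering $\mathcal U=\{U_i\}_{i\in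 I}$ of $X$ with $I$ totally ordered, put $C^n=\prod_{i_0<\dots<i_n}\mathcal O_X^*(U_{i_0}\cap\dots\cap U_{i_n})$ and, omitting restrictions, $$(d_0^+x)_{ij}=x_j,\quad (d_0^-x)_{ij}=x_i,\quad (d_1^+x)_{ijk}=x_{jk}x_{ij},\quad (d_1^-x)_{ijk}=x_{ik}.$$ Let $Z^1(\mathcal U)=\{x\in C^1: d_1^+x=d_1^-x\}$ and $\check H^1(\mathcal U,\mathcal O_X^*)=Z^1(\mathcal U)/\rho$, where $x\mathrel{\rho}y$ if and only if $x\cdot d_0^+u\cdot d_0^-v=y\cdot d_0^+v\cdot d_0^-u$ for some $u,v\in C^0$. If $\mathcal V=\{V_j\}_{j\in J}$ is a refinement of $\mathcal U$ by means of $\sigma:J\to I$, with $V_j\subseteq U_{\sigma(j)}$, then $x\mapsto (x_{\sigma(j)\sigma(k)})_{j<k}$, with the convention $x_{ii}=1$ and $x_{ji}=x_{ij}^{-1}$, induces a homomorphism $\check H^1(\mathcal U,\mathcal O_X^*)\to\check H^1(\mathcal V,\mathcal O_X^*)$, which does not depend on $\sigma$. Let $\check H^1(X,\mathcal O_X^*)=\varinjlim_{\mathcal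 U}\check H^1(\mathcal U,\mathcal O_X^*)$ over all open coverings, directed by refinement. **Theorem.** Let $X$ be a semiring scheme. Then $\operatorname{Pic}(X)$ is an abelian group with identity $[\mathcal O_X]$, and there is an isomorphism of groups $$\phi:\operatorname{Pic}(X)\xrightarrow{\ \sim\ }\check H^1(X,\mathcal O_X^*)$$ with the following property. Let $\mathcal L$ be an invertible sheaf, $\mathcal U=\{U_i\}_{i\in I}$ an open covering of $X$ with $I$ totally ordered, $\varphi_i:\mathcal O_X|_{U_i}\cong\mathcal L|_{U_i}$ isomorphisms, and $e_i=\varphi_i(1)\in\mathcal L(U_i)$. Then there is $f=(f_{ij})_{i<j}\in Z^1(\mathcal U)$ with $e_i|_{U_i\cap U_j}=f_{ij}\,e_j|_{U_i\cap U_j}$ for all $i<j$, and $\phi([\mathcal L])$ is the class of $f$. -/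

import Mathlib

open CategoryTheory TopologicalSpace Opposite
open scoped TensorProduct

universe u

namespace SemiringGeometry

/-! ## Semiringed spaces and semiring schemes -/

/-- A topological space with a sheaf of commutative semirings. -/
structure SemiringedSpace where
  carrier : TopCat.{u}
  sheaf : TopCat.Sheaf CommSemiRingCat.{u} carrier

/-- The semiring `𝒪_X(U)`. -/
abbrev SemiringedSpace.sec (X : SemiringedSpace.{u}) (U : Opens X.carrier) : Type u :=
  X.sheaf.presheaf.obj (op U)

/-- The restriction map `𝒪_X(U) → 𝒪_X(V)` for `V ⊆ U`. -/
def SemiringedSpace.res (X : SemiringedSpace.{u}) {U V : Opens X.carrier} (h : V ≤ U) :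
    X.sec U →+* X.sec V :=
  (X.sheaf.presheaf.map (homOfLE h).op).hom

section SheafFacts

variable (X : SemiringedSpace.{u})

@[simp]
theorem SemiringedSpace.res_self {U : Opens X.carrier} (h : U ≤ U) (a : X.sec U) :
    X.res h a = a := by
  simp [SemiringedSpace.res]

@[simp]
theorem SemiringedSpace.res_res {U V W : Opens X.carrier} (h : V ≤ U) (h' : W ≤ V)
    (a : X.sec U) : X.res h' (X.res h a) = X.res (h'.trans h) a := by
  have : (homOfLE (h'.trans h)).op = (homOfLE h).op ≫ (homOfLE h').op := rfl
  simp [SemiringedSpace.res, this]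

theorem SemiringedSpace.eq_of_locally_eq {U : Opens X.carrier} (a b : X.sec U)
    (H : ∀ x ∈ U, ∃ (V : Opens X.carrier) (h : V ≤ U), x ∈ V ∧ X.res h a = X.res h b) :
    a = b := by
  choose V h hx e using H
  exact X.sheaf.eq_of_locally_eq' (fun x : U => V x x.2) U (fun x => homOfLE (h x x.2))
    (fun x hxU => Opens.mem_iSup.2 ⟨⟨x, hxU⟩, hx x hxU⟩) a b (fun x => e x x.2)

theorem SemiringedSpace.exists_glue {ι : Type u} (U : ι → Opens X.carrier)
    (s : ∀ i, X.sec (U i))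
    (H : ∀ i j, X.res (inf_le_left : U i ⊓ U j ≤ U i) (s i) =
      X.res (inf_le_right : U i ⊓ U j ≤ U j) (s j)) :
    ∃ t : X.sec (iSup U), ∀ i, X.res (le_iSup U i) t = s i :=
  (X.sheaf.existsUnique_gluing U s H).exists

end SheafFacts

/-- `𝒪_{Spec R}(U)`: the functions `s` on `U` with `s(𝔭) ∈ R_𝔭` that are locally a quotient of two
elements of `R`. -/
def specSections (R : Type u) [CommSemiring R] (U : Opens (PrimeSpectrum R)) :
    Subsemiring (∀ p : U, Localization.AtPrime p.1.asIdeal) where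
  carrier := {s | ∀ p : U, ∃ V : Opens (PrimeSpectrum R), p.1 ∈ V ∧ ∃ a b : R,
    ∀ q : U, q.1 ∈ V → ∃ hb : b ∈ q.1.asIdeal.primeCompl, s q = Localization.mk a ⟨b, hb⟩}
  mul_mem' := by
    intro s t hs ht p
    obtain ⟨V, hV, a, b, h⟩ := hs p
    obtain ⟨W, hW, c, d, k⟩ := ht p
    refine ⟨V ⊓ W, ⟨hV, hW⟩, a * c, b * d, fun q hq => ?_⟩
    obtain ⟨hb, e⟩ := h q hq.1
    obtain ⟨hd, e'⟩ := k q hq.2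
    exact ⟨mul_mem hb hd, by rw [Pi.mul_apply, e, e', Localization.mk_mul]; rfl⟩
  one_mem' := fun p => ⟨⊤, trivial, 1, 1, fun q _ =>
    ⟨one_mem _, by rw [Pi.one_apply, ← Localization.mk_one]; rfl⟩⟩
  add_mem' := by
    intro s t hs ht p
    obtain ⟨V, hV, a, b, h⟩ := hs p
    obtain ⟨W, hW, c, d, k⟩ := ht p
    refine ⟨V ⊓ W, ⟨hV, hW⟩, b * c + d * a, b * d, fun q hq => ?_⟩
    obtain ⟨hb, e⟩ := h q hq.1
    obtain ⟨hd, e'⟩ := k q hq.2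
    exact ⟨mul_mem hb hd, by rw [Pi.add_apply, e, e', Localization.add_mk]; rfl⟩
  zero_mem' := fun p => ⟨⊤, trivial, 0, 1, fun q _ =>
    ⟨one_mem _, by rw [Pi.zero_apply]; exact (Localization.mk_zero _).symm⟩⟩

/-- Restriction of sections of `𝒪_{Spec R}`. -/
def specRes (R : Type u) [CommSemiring R] {U V : Opens (PrimeSpectrum R)} (h : V ≤ U)
    (s : specSections R U) : specSections R V :=
  ⟨fun p => s.1 ⟨p.1, h p.2⟩, fun p => by
    obtain ⟨W, hW, a, b, k⟩ := s.2 ⟨p.1, h p.2⟩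
    exact ⟨W, hW, a, b, fun q hq => k ⟨q.1, h q.2⟩ hq⟩⟩

/-- An isomorphism of semiringed spaces `(U, 𝒪_X|_U) ≅ Spec R`: a homeomorphism together with
isomorphisms of the semirings of sections over corresponding open sets, compatible with
restrictions. -/
structure AffineChart (X : SemiringedSpace.{u}) (U : Opens X.carrier)
    (R : Type u) [CommSemiring R] where
  homeo : PrimeSpectrum R ≃ₜ U
  /-- the open subset of `X` corresponding to an open subset of `Spec R` -/
  image : Opens (PrimeSpectrum R) → Opens X.carrier
  coe_image : ∀ V, (image V : Set X.carrier) = (fun p => (homeo p : X.carrier)) '' V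
  equiv : ∀ V, specSections R V ≃+* X.sec (image V)
  naturality : ∀ {V W : Opens (PrimeSpectrum R)} (h : W ≤ V) (h' : image W ≤ image V)
    (s : specSections R V), equiv W (specRes R h s) = X.res h' (equiv V s)

/-- A semiring scheme: a semiringed space that is locally isomorphic to prime spectra of
commutative semirings. -/
structure SemiringScheme extends SemiringedSpace.{u} where
  locally_affine : ∀ x : carrier, ∃ U : Opens carrier, x ∈ U ∧
    ∃ (R : Type u) (_ : CommSemiring R), Nonempty (AffineChart toSemiringedSpace U R)

/-! ## Sheaves of semimodules -/

/-- A presheaf of `𝒪_X`-semimodules. -/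
structure SemimodulePresheaf (X : SemiringedSpace.{u}) where
  obj : Opens X.carrier → Type u
  [addCommMonoid : ∀ U, AddCommMonoid (obj U)]
  [module : ∀ U, Module (X.sec U) (obj U)]
  /-- restriction maps, semilinear along the restriction maps of `𝒪_X` -/
  res : ∀ {U V : Opens X.carrier} (h : V ≤ U), obj U →ₛₗ[X.res h] obj V
  res_self : ∀ {U : Opens X.carrier} (h : U ≤ U) (s : obj U), res h s = s
  res_res : ∀ {U V W : Opens X.carrier} (h : V ≤ U) (h' : W ≤ V) (s : obj U),
    res h' (res h s) = res (h'.trans h) s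

attribute [instance] SemimodulePresheaf.addCommMonoid SemimodulePresheaf.module
attribute [simp] SemimodulePresheaf.res_self SemimodulePresheaf.res_res

/-- A sheaf of `𝒪_X`-semimodules. -/
structure SemimoduleSheaf (X : SemiringedSpace.{u}) extends SemimodulePresheaf X where
  eq_of_locally_eq : ∀ {U : Opens X.carrier} (s t : obj U),
    (∀ x ∈ U, ∃ (V : Opens X.carrier) (h : V ≤ U), x ∈ V ∧ res h s = res h t) → s = t
  exists_glue : ∀ {ι : Type u} (U : ι → Opens X.carrier) (s : ∀ i, obj (U i)),
    (∀ i j, res (inf_le_left : U i ⊓ U j ≤ U i) (s i) =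
      res (inf_le_right : U i ⊓ U j ≤ U j) (s j)) →
    ∃ t : obj (iSup U), ∀ i, res (le_iSup U i) t = s i

/-- `𝒪_X` as a sheaf of semimodules over itself. -/
abbrev structureSheaf (X : SemiringedSpace.{u}) : SemimoduleSheaf X where
  obj U := X.sec U
  res h := { toFun := X.res h, map_add' := map_add _, map_smul' := fun a s => map_mul _ a s }
  res_self h s := X.res_self h s
  res_res h h' s := X.res_res h h' s
  eq_of_locally_eq := X.eq_of_locally_eq
  exists_glue := X.exists_glue

/-- An isomorphism `F|_U ≅ G|_U` of `𝒪_X|_U`-semimodules. -/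
structure IsoOver {X : SemiringedSpace.{u}} (U : Opens X.carrier)
    (F G : SemimodulePresheaf X) where
  equiv : ∀ V, V ≤ U → (F.obj V ≃ₗ[X.sec V] G.obj V)
  naturality : ∀ {V W : Opens X.carrier} (hV : V ≤ U) (h : W ≤ V) (s : F.obj V),
    equiv W (h.trans hV) (F.res h s) = G.res h (equiv V hV s)

/-- A sheaf of semimodules is invertible if it is locally isomorphic to `𝒪_X`. -/
def IsInvertible {X : SemiringedSpace.{u}} (L : SemimoduleSheaf X) : Prop :=
  ∀ x : X.carrier, ∃ U : Opens X.carrier, x ∈ U ∧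
    Nonempty (IsoOver U (structureSheaf X).toSemimodulePresheaf L.toSemimodulePresheaf)

/-! ## The tensor product of sheaves -/

section Tensor

variable {X : SemiringedSpace.{u}}

/-- The restriction map `F(U) ⊗ G(U) → F(V) ⊗ G(V)`, sending `s ⊗ t` to `s|_V ⊗ t|_V`. -/
noncomputable def tensorRes (F G : SemimodulePresheaf X) {U V : Opens X.carrier} (h : V ≤ U) :
    (F.obj U ⊗[X.sec U] G.obj U) →ₛₗ[X.res h] (F.obj V ⊗[X.sec V] G.obj V) :=
  TensorProduct.lift (LinearMap.mk₂'ₛₗ (X.res h) (X.res h)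
    (fun s t => F.res h s ⊗ₜ[X.sec V] G.res h t)
    (fun s s' t => by rw [map_add, TensorProduct.add_tmul])
    (fun a s t => by rw [LinearMap.map_smulₛₗ, TensorProduct.smul_tmul'])
    (fun s t t' => by rw [map_add, TensorProduct.tmul_add])
    (fun a s t => by rw [LinearMap.map_smulₛₗ, TensorProduct.tmul_smul]))

@[simp]
theorem tensorRes_tmul (F G : SemimodulePresheaf X) {U V : Opens X.carrier} (h : V ≤ U)
    (s : F.obj U) (t : G.obj U) :
    tensorRes F G h (s ⊗ₜ t) = F.res h s ⊗ₜ G.res h t := rfl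

/-- The presheaf `U ↦ F(U) ⊗_{𝒪_X(U)} G(U)`. Mathlib's tensor product of semimodules over a
commutative semiring is the one representing bilinear maps. -/
noncomputable def tensorPresheaf (F G : SemimodulePresheaf X) : SemimodulePresheaf X where
  obj U := F.obj U ⊗[X.sec U] G.obj U
  res h := tensorRes F G h
  res_self h s := by
    induction s using TensorProduct.induction_on with
    | zero => simp
    | tmul a b => simp
    | add a b ha hb => rw [map_add, ha, hb]
  res_res h h' s := by
    induction s using TensorProduct.induction_on with
    | zero => simp
    | tmul a b => simp
    | add a b ha hb => simp only [map_add, ha, hb]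

end Tensor

/-! ## Sheafification -/

section Sheafify

variable {X : SemiringedSpace.{u}} (P : SemimodulePresheaf X)

namespace SemimodulePresheaf

/-- An open neighbourhood of a point. -/
@[ext]
structure Nhds (x : X.carrier) where
  set : Opens X.carrier
  mem : x ∈ set

/-- Neighbourhoods are ordered by reverse inclusion. -/
instance (x : X.carrier) : Preorder (Nhds x) where
  le a b := b.set ≤ a.set
  le_refl a := le_refl a.set
  le_trans _ _ _ h h' := le_trans h' h

instance (x : X.carrier) : Nonempty (Nhds x) := ⟨⟨⊤, trivial⟩⟩

instance (x : X.carrier) : IsDirectedOrder (Nhds x) where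
  directed a b := ⟨⟨a.set ⊓ b.set, ⟨a.mem, b.mem⟩⟩,
    (inf_le_left : a.set ⊓ b.set ≤ _), (inf_le_right : a.set ⊓ b.set ≤ _)⟩

/-- The transition maps of the directed system defining the stalk. -/
def stalkMap (x : X.carrier) (a b : Nhds x) (h : a ≤ b) : P.obj a.set →+ P.obj b.set :=
  (P.res (show b.set ≤ a.set from h)).toAddMonoidHom

theorem stalkMap_apply (x : X.carrier) (a b : Nhds x) (h : a ≤ b) (s : P.obj a.set) :
    P.stalkMap x a b h s = P.res (show b.set ≤ a.set from h) s := rfl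

instance (x : X.carrier) :
    DirectedSystem (fun a : Nhds x => P.obj a.set) (P.stalkMap x · · ·) where
  map_self _ s := P.res_self _ s
  map_map _ _ _ _ _ s := P.res_res _ _ s

/-- The stalk of a presheaf of semimodules: the colimit of `P(U)` over the open neighbourhoods `U`
of the point. -/
abbrev stalk (x : X.carrier) : Type u :=
  DirectLimit (fun a : Nhds x => P.obj a.set) (P.stalkMap x)

/-- The germ at `x` of a section. -/
def germ {x : X.carrier} {U : Opens X.carrier} (hx : x ∈ U) (s : P.obj U) : P.stalk x :=
  Quotient.mk _ (Sigma.mk (β := fun a : Nhds x => P.obj a.set) ⟨U, hx⟩ s)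

variable {P}

theorem germ_res {x : X.carrier} {U V : Opens X.carrier} (h : V ≤ U) (hx : x ∈ V)
    (s : P.obj U) : P.germ hx (P.res h s) = P.germ (h hx) s :=
  (DirectLimit.eq_of_le (F := fun a : Nhds x => P.obj a.set) (f := P.stalkMap x)
    (Sigma.mk (β := fun a : Nhds x => P.obj a.set) ⟨U, h hx⟩ s) ⟨V, hx⟩ h).symm

theorem germ_ind {x : X.carrier} {p : P.stalk x → Prop} {U : Opens X.carrier} (hU : x ∈ U)
    (H : ∀ (V : Opens X.carrier) (_ : V ≤ U) (hx : x ∈ V) (s : P.obj V), p (P.germ hx s))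
    (z : P.stalk x) : p z := by
  obtain ⟨⟨V, hV⟩, s, rfl⟩ := DirectLimit.exists_eq_mk (P.stalkMap x) z
  have := H (V ⊓ U) inf_le_right ⟨hV, hU⟩ (P.res inf_le_left s)
  have e := germ_res (P := P) (inf_le_left : V ⊓ U ≤ V) ⟨hV, hU⟩ s
  rw [e] at this
  exact this

theorem germ_eq_iff {x : X.carrier} {U V : Opens X.carrier} (hU : x ∈ U) (hV : x ∈ V)
    (s : P.obj U) (t : P.obj V) : P.germ hU s = P.germ hV t ↔
      ∃ (W : Opens X.carrier) (_ : x ∈ W) (h : W ≤ U) (h' : W ≤ V), P.res h s = P.res h' t := by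
  constructor
  · intro e
    obtain ⟨⟨W, hW⟩, h, h', e⟩ := Quotient.exact e
    exact ⟨W, hW, h, h', e⟩
  · rintro ⟨W, hW, h, h', e⟩
    rw [← germ_res h hW, e, germ_res]

theorem germ_add {x : X.carrier} {U : Opens X.carrier} (hx : x ∈ U) (s t : P.obj U) :
    P.germ hx (s + t) = P.germ hx s + P.germ hx t :=
  (DirectLimit.add_def (G := fun a : Nhds x => P.obj a.set) (f := P.stalkMap x) ⟨U, hx⟩ s t).symm

theorem germ_zero {x : X.carrier} {U : Opens X.carrier} (hx : x ∈ U) :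
    P.germ hx (0 : P.obj U) = 0 :=
  (DirectLimit.zero_def (f := P.stalkMap x) (⟨U, hx⟩ : Nhds x)).symm

/-- The action of `𝒪_X(U)` on the stalk at a point `x` of `U`: the germ at `x` of a section `t`
over `V` is sent by `a` to the germ of `a|_{V ∩ U} • t|_{V ∩ U}`. -/
instance stalkSMul {U : Opens X.carrier} (x : U) : SMul (X.sec U) (P.stalk x.1) where
  smul a := DirectLimit.lift (P.stalkMap x.1)
    (fun i t => P.germ (U := i.set ⊓ U) (show x.1 ∈ i.set ⊓ U from ⟨i.mem, x.2⟩)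
      (X.res (inf_le_right : i.set ⊓ U ≤ U) a • P.res (inf_le_left : i.set ⊓ U ≤ i.set) t))
    (fun i j h t => (germ_eq_iff _ _ _ _).2
      ⟨j.set ⊓ U, ⟨j.mem, x.2⟩, inf_le_inf_right U h, le_rfl, by
        simp only [stalkMap_apply, LinearMap.map_smulₛₗ, X.res_res, P.res_res]⟩)

theorem smul_germ {U V : Opens X.carrier} (x : U) (h : V ≤ U) (hx : x.1 ∈ V) (a : X.sec U)
    (s : P.obj V) : a • P.germ hx s = P.germ hx (X.res h a • s) := by
  change P.germ (U := V ⊓ U) (show x.1 ∈ V ⊓ U from ⟨hx, x.2⟩)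
    (X.res (inf_le_right : V ⊓ U ≤ U) a • P.res (inf_le_left : V ⊓ U ≤ V) s) = _
  rw [germ_eq_iff]
  exact ⟨V ⊓ U, ⟨hx, x.2⟩, le_rfl, inf_le_left, by simp⟩

noncomputable instance stalkModule {U : Opens X.carrier} (x : U) : Module (X.sec U) (P.stalk x.1) where
  one_smul := germ_ind x.2 fun V h hx s => by rw [smul_germ x h, map_one, one_smul]
  mul_smul a b := germ_ind x.2 fun V h hx s => by
    rw [smul_germ x h, smul_germ x h, smul_germ x h, map_mul, mul_smul]
  smul_zero a := by
    rw [← germ_zero x.2, smul_germ x le_rfl, smul_zero]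
  smul_add a := germ_ind x.2 fun V h hx s => germ_ind hx fun W h' hx' t => by
    rw [← germ_res h' hx', ← germ_add, smul_germ x (h'.trans h), smul_germ x (h'.trans h),
      smul_germ x (h'.trans h), ← germ_add, smul_add]
  add_smul a b := germ_ind x.2 fun V h hx s => by
    rw [smul_germ x h, smul_germ x h, smul_germ x h, map_add, add_smul, germ_add]
  zero_smul := germ_ind x.2 fun V h hx s => by
    rw [smul_germ x h, map_zero, zero_smul, germ_zero]

variable (P)

/-- Sections over `U` of the sheafification: functions assigning to each `x ∈ U` an element of the
stalk at `x` that are locally given by germs of sections of the presheaf. -/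
noncomputable def sheafifySections (U : Opens X.carrier) : Submodule (X.sec U) (∀ x : U, P.stalk x.1) where
  carrier := {s | ∀ x : U, ∃ (V : Opens X.carrier) (h : V ≤ U) (_ : x.1 ∈ V) (t : P.obj V),
    ∀ (y : X.carrier) (hy : y ∈ V), s ⟨y, h hy⟩ = P.germ hy t}
  add_mem' := by
    intro s t hs ht x
    obtain ⟨V, hV, hx, a, ha⟩ := hs x
    obtain ⟨W, hW, hx', b, hb⟩ := ht x
    refine ⟨V ⊓ W, inf_le_left.trans hV, ⟨hx, hx'⟩,
      P.res inf_le_left a + P.res inf_le_right b, fun y hy => ?_⟩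
    rw [Pi.add_apply, ha y hy.1, hb y hy.2, germ_add, germ_res, germ_res]
  zero_mem' := fun x => ⟨U, le_rfl, x.2, 0, fun y hy => (germ_zero hy).symm⟩
  smul_mem' := by
    intro c s hs x
    obtain ⟨V, hV, hx, a, ha⟩ := hs x
    refine ⟨V, hV, hx, X.res hV c • a, fun y hy => ?_⟩
    rw [Pi.smul_apply, ha y hy, smul_germ ⟨y, hV hy⟩ hV]

theorem res_smul_stalk {U V : Opens X.carrier} (h : V ≤ U) (x : V) (a : X.sec U)
    (z : P.stalk x.1) : X.res h a • z = (a • (show P.stalk (⟨x.1, h x.2⟩ : U).1 from z)) := by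
  revert z
  refine germ_ind x.2 fun W hW hx s => ?_
  rw [smul_germ x hW]
  refine Eq.trans ?_ (smul_germ (⟨x.1, h x.2⟩ : U) (hW.trans h) hx a s).symm
  simp

/-- The sheafification of a presheaf of semimodules. -/
noncomputable def sheafify : SemimoduleSheaf X where
  obj U := P.sheafifySections U
  res {U V} h :=
    { toFun := fun s => ⟨fun x => s.1 ⟨x.1, h x.2⟩, fun x => by
        obtain ⟨W, hW, hx, t, ht⟩ := s.2 ⟨x.1, h x.2⟩
        exact ⟨W ⊓ V, inf_le_right, ⟨hx, x.2⟩, P.res inf_le_left t, fun y hy => by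
          rw [germ_res]; exact ht y hy.1⟩⟩
      map_add' := fun _ _ => rfl
      map_smul' := fun a s => Subtype.ext (funext fun x =>
        (P.res_smul_stalk h x a (s.1 ⟨x.1, h x.2⟩)).symm) }
  res_self _ _ := rfl
  res_res _ _ _ := rfl
  eq_of_locally_eq s t H := Subtype.ext (funext fun x => by
    obtain ⟨V, h, hx, e⟩ := H x.1 x.2
    exact congrFun (congrArg Subtype.val e) ⟨x.1, hx⟩)
  exists_glue U s H := by
    have key : ∀ x : (iSup U : Opens X.carrier), ∃ i, x.1 ∈ U i := fun x => Opens.mem_iSup.1 x.2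
    choose i hi using key
    have agree : ∀ (x : (iSup U : Opens X.carrier)) (j) (hj : x.1 ∈ U j),
        (s (i x)).1 ⟨x.1, hi x⟩ = (s j).1 ⟨x.1, hj⟩ := fun x j hj =>
      congrFun (congrArg Subtype.val (H (i x) j)) ⟨x.1, hi x, hj⟩
    refine ⟨⟨fun x => (s (i x)).1 ⟨x.1, hi x⟩, fun x => ?_⟩, fun j => Subtype.ext (funext fun x =>
      agree ⟨x.1, le_iSup U j x.2⟩ j x.2)⟩
    obtain ⟨V, h, hx, t, ht⟩ := (s (i x)).2 ⟨x.1, hi x⟩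
    exact ⟨V, h.trans (le_iSup U _), hx, t, fun y hy =>
      (agree ⟨y, le_iSup U (i x) (h hy)⟩ (i x) (h hy)).trans (ht y hy)⟩

end SemimodulePresheaf

/-- The tensor product `F ⊗_{𝒪_X} G` of sheaves of semimodules. -/
noncomputable def tensorSheaf (F G : SemimoduleSheaf X) : SemimoduleSheaf X :=
  (tensorPresheaf F.toSemimodulePresheaf G.toSemimodulePresheaf).sheafify

end Sheafify

/-! ## Invertible sheaves and the Picard group -/

section Picard

variable {X : SemiringedSpace.{u}}

/-- The canonical map from a presheaf to its sheafification. -/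
noncomputable def SemimodulePresheaf.toSheafify (P : SemimodulePresheaf X) (U : Opens X.carrier) :
    P.obj U →ₗ[X.sec U] P.sheafify.obj U where
  toFun s := ⟨fun x => P.germ x.2 s, fun x => ⟨U, le_rfl, x.2, s, fun _ _ => rfl⟩⟩
  map_add' s t := Subtype.ext (funext fun x => SemimodulePresheaf.germ_add x.2 s t)
  map_smul' a s := Subtype.ext (funext fun x => by
    refine Eq.trans ?_ (SemimodulePresheaf.smul_germ x le_rfl x.2 a s).symm
    rw [X.res_self])

/-- Restriction of an isomorphism to a smaller open set. -/
def IsoOver.restrict {U V : Opens X.carrier} {F G : SemimodulePresheaf X} (e : IsoOver U F G)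
    (h : V ≤ U) : IsoOver V F G where
  equiv W hW := e.equiv W (hW.trans h)
  naturality hV h' s := e.naturality (hV.trans h) h' s

/-- A presheaf of semimodules isomorphic over `U` to a sheaf is isomorphic over `U` to its
sheafification. -/
noncomputable def IsoOver.sheafify {U : Opens X.carrier} {F : SemimoduleSheaf X}
    {P : SemimodulePresheaf X} (e : IsoOver U F.toSemimodulePresheaf P) :
    IsoOver U F.toSemimodulePresheaf P.sheafify.toSemimodulePresheaf where
  equiv V hV := LinearEquiv.ofBijective ((P.toSheafify V).comp (e.equiv V hV).toLinearMap) (by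
    constructor
    · intro s t h
      refine F.eq_of_locally_eq s t fun x hx => ?_
      have h' : P.germ hx (e.equiv V hV s) = P.germ hx (e.equiv V hV t) :=
        congrFun (congrArg Subtype.val h) ⟨x, hx⟩
      obtain ⟨W, hW, k, _, E⟩ := (SemimodulePresheaf.germ_eq_iff hx hx _ _).1 h'
      refine ⟨W, k, hW, (e.equiv W (k.trans hV)).injective ?_⟩
      rw [e.naturality hV, e.naturality hV, E]
    · intro s
      choose W hW hx t ht using s.2
      let a : ∀ x : V, F.obj (W x) := fun x => (e.equiv (W x) ((hW x).trans hV)).symm (t x)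
      have ha : ∀ x, e.equiv (W x) ((hW x).trans hV) (a x) = t x := fun x =>
        LinearEquiv.apply_symm_apply _ _
      obtain ⟨b, hb⟩ := F.exists_glue W a (fun x y => by
        refine F.eq_of_locally_eq _ _ fun z hz => ?_
        have h1 : P.germ hz.1 (t x) = P.germ hz.2 (t y) :=
          (ht x z hz.1).symm.trans (ht y z hz.2)
        obtain ⟨N, hN, k, k', E⟩ := (SemimodulePresheaf.germ_eq_iff _ _ _ _).1 h1
        refine ⟨N, le_inf k k', hN, ?_⟩
        rw [F.res_res, F.res_res]
        apply (e.equiv N (k.trans ((hW x).trans hV))).injective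
        rw [e.naturality ((hW x).trans hV), e.naturality ((hW y).trans hV), ha, ha, E])
      have hVW : V ≤ iSup W := fun z hz => Opens.mem_iSup.2 ⟨⟨z, hz⟩, hx ⟨z, hz⟩⟩
      refine ⟨F.res hVW b, Subtype.ext (funext fun x => ?_)⟩
      change P.germ x.2 (e.equiv V hV (F.res hVW b)) = _
      rw [← SemimodulePresheaf.germ_res (hW x) (hx x), ← e.naturality hV, F.res_res, hb, ha]
      exact (ht x x.1 (hx x)).symm)
  naturality {V W} hV h s := Subtype.ext (funext fun x => by
    change P.germ x.2 (e.equiv W (h.trans hV) (F.res h s)) = P.germ (h x.2) (e.equiv V hV s)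
    rw [e.naturality hV, SemimodulePresheaf.germ_res])

/-- Isomorphisms `𝒪_X|_U ≅ F|_U` and `𝒪_X|_U ≅ G|_U` give `𝒪_X|_U ≅ (F ⊗ G)|_U` for the tensor
product presheaf. -/
noncomputable def IsoOver.tensor {U : Opens X.carrier} {F G : SemimodulePresheaf X}
    (e : IsoOver U (structureSheaf X).toSemimodulePresheaf F)
    (e' : IsoOver U (structureSheaf X).toSemimodulePresheaf G) :
    IsoOver U (structureSheaf X).toSemimodulePresheaf (tensorPresheaf F G) where
  equiv V hV := (TensorProduct.lid (X.sec V) (X.sec V)).symm.trans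
    (TensorProduct.congr (e.equiv V hV) (e'.equiv V hV))
  naturality {V W} hV h s := by
    have h1 := e.naturality hV h (1 : X.sec V)
    have h2 : (structureSheaf X).res h (1 : X.sec V) = (1 : X.sec W) := map_one (X.res h)
    rw [h2] at h1
    exact congrArg₂ (fun a b => a ⊗ₜ[X.sec W] b) h1 (e'.naturality hV h s)

theorem isInvertible_structureSheaf (X : SemiringedSpace.{u}) :
    IsInvertible (structureSheaf X) := fun _ =>
  ⟨⊤, trivial, ⟨{ equiv := fun _ _ => LinearEquiv.refl _ _, naturality := fun _ _ _ => rfl }⟩⟩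

theorem IsInvertible.tensor {F G : SemimoduleSheaf X} (hF : IsInvertible F)
    (hG : IsInvertible G) : IsInvertible (tensorSheaf F G) := fun x => by
  obtain ⟨U, hU, ⟨e⟩⟩ := hF x
  obtain ⟨V, hV, ⟨e'⟩⟩ := hG x
  exact ⟨U ⊓ V, ⟨hU, hV⟩,
    ⟨((e.restrict inf_le_left).tensor (e'.restrict inf_le_right)).sheafify⟩⟩

variable (X) in
/-- The invertible sheaves of `𝒪_X`-semimodules. -/
abbrev InvertibleSheaf : Type (u + 1) := {L : SemimoduleSheaf X // IsInvertible L}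

/-- `𝒪_X` as an invertible sheaf. -/
def InvertibleSheaf.unit (X : SemiringedSpace.{u}) : InvertibleSheaf X :=
  ⟨structureSheaf X, isInvertible_structureSheaf X⟩

/-- The tensor product of invertible sheaves. -/
noncomputable def InvertibleSheaf.tensor (L M : InvertibleSheaf X) : InvertibleSheaf X :=
  ⟨tensorSheaf L.1 M.1, L.2.tensor M.2⟩

variable (X) in
/-- Isomorphism of invertible sheaves on `X`. -/
instance InvertibleSheaf.setoid : Setoid (InvertibleSheaf X) where
  r L M := Nonempty (IsoOver ⊤ L.1.toSemimodulePresheaf M.1.toSemimodulePresheaf)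
  iseqv :=
    { refl := fun _ =>
        ⟨{ equiv := fun _ _ => LinearEquiv.refl _ _, naturality := fun _ _ _ => rfl }⟩
      symm := fun {L M} ⟨e⟩ =>
        ⟨{ equiv := fun V hV => (e.equiv V hV).symm
           naturality := fun {V W} hV h s => by
            rw [LinearEquiv.symm_apply_eq, e.naturality hV, LinearEquiv.apply_symm_apply] }⟩
      trans := fun {L M N} ⟨e⟩ ⟨e'⟩ =>
        ⟨{ equiv := fun V hV => (e.equiv V hV).trans (e'.equiv V hV)
           naturality := fun {V W} hV h s => by
            simp only [LinearEquiv.trans_apply]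
            rw [e.naturality hV, e'.naturality hV] }⟩ }

variable (X) in
/-- The set of isomorphism classes of invertible sheaves on `X`. -/
def Pic : Type (u + 1) := Quotient (InvertibleSheaf.setoid X)

/-- The isomorphism class of an invertible sheaf. -/
def InvertibleSheaf.isoClass (L : InvertibleSheaf X) : Pic X := Quotient.mk _ L

end Picard

/-! ## Cohomology of a complex with pairs of coboundary maps

For abelian groups, written multiplicatively, and pairs of homomorphisms `d₀⁺, d₀⁻ : A → B` and
`d₁⁺, d₁⁻ : B → C`. -/

section PairCohomology

variable {A B C : Type*} [CommGroup A] [CommGroup B] [CommGroup C]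

/-- The cocycles: the elements `x` of `B` with `d₁⁺ x = d₁⁻ x`. -/
abbrev pairCocycles (dp dm : B →* C) : Subgroup B := dp.eqLocus dm

/-- The congruence `ρ` on cocycles: `x ρ y` if and only if
`x · d₀⁺ u · d₀⁻ v = y · d₀⁺ v · d₀⁻ u` for some `u, v`. -/
def pairCon (ep em : A →* B) (Z : Subgroup B) : Con Z where
  r x y := ∃ u v : A, (x : B) * ep u * em v = y * ep v * em u
  iseqv :=
    { refl := fun _ => ⟨1, 1, rfl⟩
      symm := fun ⟨u, v, h⟩ => ⟨v, u, h.symm⟩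
      trans := fun {x y z} ⟨u, v, h⟩ ⟨u', v', h'⟩ => ⟨u * u', v * v', by
        simp only [map_mul]
        calc (x : B) * (ep u * ep u') * (em v * em v')
            = (x * ep u * em v) * (ep u' * em v') := by
              simp only [mul_left_comm, mul_comm]
          _ = (y * ep u' * em v') * (ep v * em u) := by
              rw [h]; simp only [mul_left_comm, mul_comm]
          _ = z * (ep v * ep v') * (em u * em u') := by
              rw [h']; simp only [mul_left_comm, mul_comm]⟩ }
  mul' := fun {w x y z} ⟨u, v, h⟩ ⟨u', v', h'⟩ => ⟨u * u', v * v', by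
    simp only [map_mul, Subgroup.coe_mul]
    calc (w * y : B) * (ep u * ep u') * (em v * em v')
        = (w * ep u * em v) * (y * ep u' * em v') := by
          simp only [mul_assoc, mul_left_comm, mul_comm]
      _ = (x * z : B) * (ep v * ep v') * (em u * em u') := by
          rw [h, h']; simp only [mul_assoc, mul_left_comm, mul_comm]⟩

/-- The cohomology group: cocycles modulo `ρ`. -/
abbrev PairCohomology (ep em : A →* B) (dp dm : B →* C) : Type _ :=
  (pairCon ep em (pairCocycles dp dm)).Quotient

theorem pairCon_iff (ep em : A →* B) (Z : Subgroup B) (x y : Z) :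
    pairCon ep em Z x y ↔ ∃ w : A, (x : B) * em w = y * ep w := by
  constructor
  · rintro ⟨u, v, h⟩
    refine ⟨v * u⁻¹, ?_⟩
    have h' : (x : B) * em v = y * ep v * em u * (ep u)⁻¹ := by
      rw [← h, mul_right_comm, mul_inv_cancel_right]
    rw [map_mul, map_mul, map_inv, map_inv, ← mul_assoc, h', mul_right_comm (_ * _) (em u),
      mul_inv_cancel_right, mul_assoc]
  · rintro ⟨w, h⟩
    exact ⟨1, w, by simpa using h⟩

end PairCohomology

/-! ## Čech cohomology of the sheaf of units -/

section Cech

variable {X : SemiringedSpace.{u}}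

/-- The group `𝒪_X^*(U)` of invertible elements of `𝒪_X(U)`. -/
abbrev SemiringedSpace.units (X : SemiringedSpace.{u}) (U : Opens X.carrier) : Type u :=
  (X.sec U)ˣ

/-- The restriction maps of `𝒪_X^*`. -/
def SemiringedSpace.unitsRes (X : SemiringedSpace.{u}) {U V : Opens X.carrier} (h : V ≤ U) :
    X.units U →* X.units V :=
  Units.map (X.res h : X.sec U →* X.sec V)

@[simp]
theorem SemiringedSpace.coe_unitsRes {U V : Opens X.carrier} (h : V ≤ U) (a : X.units U) :
    (X.unitsRes h a : X.sec V) = X.res h a := rfl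

@[simp]
theorem SemiringedSpace.unitsRes_self {U : Opens X.carrier} (h : U ≤ U) (a : X.units U) :
    X.unitsRes h a = a := Units.ext (X.res_self h a)

@[simp]
theorem SemiringedSpace.unitsRes_res {U V W : Opens X.carrier} (h : V ≤ U) (h' : W ≤ V)
    (a : X.units U) : X.unitsRes h' (X.unitsRes h a) = X.unitsRes (h'.trans h) a :=
  Units.ext (X.res_res h h' a)

variable (X) in
/-- An open covering of `X` indexed by a totally ordered set. -/
structure OpenCover where
  ι : Type u
  [linearOrder : LinearOrder ι]
  set : ι → Opens X.carrier
  exists_mem : ∀ x : X.carrier, ∃ i, x ∈ set i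

attribute [instance] OpenCover.linearOrder

namespace OpenCover

variable (𝒰 𝒱 : OpenCover X)

/-- The pairs `i < j` of indices. -/
abbrev Pairs : Type u := {p : 𝒰.ι × 𝒰.ι // p.1 < p.2}

/-- The triples `i < j < k` of indices. -/
abbrev Triples : Type u := {t : 𝒰.ι × 𝒰.ι × 𝒰.ι // t.1 < t.2.1 ∧ t.2.1 < t.2.2}

/-- `U_{ij} = U_i ∩ U_j`. -/
abbrev inter₂ (i j : 𝒰.ι) : Opens X.carrier := 𝒰.set i ⊓ 𝒰.set j

/-- `U_{ijk} = U_i ∩ U_j ∩ U_k`. -/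
abbrev inter₃ (i j k : 𝒰.ι) : Opens X.carrier := 𝒰.set i ⊓ 𝒰.set j ⊓ 𝒰.set k

/-- `C⁰(𝒰, 𝒪_X^*) = ∏_i 𝒪_X^*(U_i)`. -/
abbrev C0 : Type u := ∀ i : 𝒰.ι, X.units (𝒰.set i)

/-- `C¹(𝒰, 𝒪_X^*) = ∏_{i < j} 𝒪_X^*(U_{ij})`. -/
abbrev C1 : Type u := ∀ p : 𝒰.Pairs, X.units (𝒰.inter₂ p.1.1 p.1.2)

/-- `C²(𝒰, 𝒪_X^*) = ∏_{i < j < k} 𝒪_X^*(U_{ijk})`. -/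
abbrev C2 : Type u := ∀ t : 𝒰.Triples, X.units (𝒰.inter₃ t.1.1 t.1.2.1 t.1.2.2)

/-- `(d₀⁺ x)_{ij} = x_j`. -/
def d0p : 𝒰.C0 →* 𝒰.C1 where
  toFun x p := X.unitsRes inf_le_right (x p.1.2)
  map_one' := funext fun _ => map_one _
  map_mul' _ _ := funext fun _ => map_mul _ _ _

/-- `(d₀⁻ x)_{ij} = x_i`. -/
def d0m : 𝒰.C0 →* 𝒰.C1 where
  toFun x p := X.unitsRes inf_le_left (x p.1.1)
  map_one' := funext fun _ => map_one _
  map_mul' _ _ := funext fun _ => map_mul _ _ _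

theorem inter₃_le_left (i j k : 𝒰.ι) : 𝒰.inter₃ i j k ≤ 𝒰.inter₂ i j := inf_le_left

theorem inter₃_le_right (i j k : 𝒰.ι) : 𝒰.inter₃ i j k ≤ 𝒰.inter₂ j k :=
  inf_le_inf_right _ inf_le_right

theorem inter₃_le_outer (i j k : 𝒰.ι) : 𝒰.inter₃ i j k ≤ 𝒰.inter₂ i k :=
  inf_le_inf_right _ inf_le_left

/-- `(d₁⁺ x)_{ijk} = x_{jk} x_{ij}`. -/
def d1p : 𝒰.C1 →* 𝒰.C2 where
  toFun x t := X.unitsRes (𝒰.inter₃_le_right _ _ _) (x ⟨(t.1.2.1, t.1.2.2), t.2.2⟩) *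
    X.unitsRes (𝒰.inter₃_le_left _ _ _) (x ⟨(t.1.1, t.1.2.1), t.2.1⟩)
  map_one' := by
    funext t
    simp only [Pi.one_apply, map_one, mul_one]
  map_mul' x y := by
    funext t
    simp only [Pi.mul_apply, map_mul]
    exact mul_mul_mul_comm _ _ _ _

/-- `(d₁⁻ x)_{ijk} = x_{ik}`. -/
def d1m : 𝒰.C1 →* 𝒰.C2 where
  toFun x t := X.unitsRes (𝒰.inter₃_le_outer _ _ _) (x ⟨(t.1.1, t.1.2.2), t.2.1.trans t.2.2⟩)
  map_one' := funext fun _ => map_one _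
  map_mul' _ _ := funext fun _ => map_mul _ _ _

/-- `Z¹(𝒰, 𝒪_X^*)`. -/
abbrev Z1 : Subgroup 𝒰.C1 := pairCocycles 𝒰.d1p 𝒰.d1m

/-- `Ȟ¹(𝒰, 𝒪_X^*)`. -/
abbrev H1 : Type u := PairCohomology 𝒰.d0p 𝒰.d0m 𝒰.d1p 𝒰.d1m

/-- The alternating extension of a `1`-cochain to all pairs of indices: `f_{ij}` if `i < j`,
`f_{ji}⁻¹` if `j < i`, and `1` if `i = j`. -/
def ext (i j : 𝒰.ι) : 𝒰.C1 →* X.units (𝒰.inter₂ i j) :=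
  if h : i < j then Pi.evalMonoidHom _ (⟨(i, j), h⟩ : 𝒰.Pairs)
  else if h : j < i then
    invMonoidHom.comp ((X.unitsRes (le_inf inf_le_right inf_le_left)).comp
      (Pi.evalMonoidHom _ (⟨(j, i), h⟩ : 𝒰.Pairs)))
  else 1

variable {𝒰 𝒱}

theorem ext_of_lt {i j : 𝒰.ι} (h : i < j) (f : 𝒰.C1) : 𝒰.ext i j f = f ⟨(i, j), h⟩ := by
  rw [ext, dif_pos h]; rfl

theorem ext_of_gt {i j : 𝒰.ι} (h : j < i) (f : 𝒰.C1) :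
    𝒰.ext i j f = (X.unitsRes (le_inf inf_le_right inf_le_left) (f ⟨(j, i), h⟩))⁻¹ := by
  rw [ext, dif_neg h.not_gt, dif_pos h]; rfl

theorem ext_self (i : 𝒰.ι) (f : 𝒰.C1) : 𝒰.ext i i f = 1 := by
  rw [ext, dif_neg (lt_irrefl i), dif_neg (lt_irrefl i)]; rfl

/-- The restriction of the alternating extension to an open subset of `U_i ∩ U_j`. -/
def extOn {W : Opens X.carrier} {i j : 𝒰.ι} (hi : W ≤ 𝒰.set i) (hj : W ≤ 𝒰.set j) (f : 𝒰.C1) :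
    X.units W := X.unitsRes (le_inf hi hj) (𝒰.ext i j f)

section extOn

variable {W : Opens X.carrier} {i j k : 𝒰.ι} (hi : W ≤ 𝒰.set i) (hj : W ≤ 𝒰.set j)
  (hk : W ≤ 𝒰.set k) (f : 𝒰.C1)

theorem extOn_self (hi' : W ≤ 𝒰.set i) : extOn hi hi' f = 1 := by
  rw [extOn, ext_self, map_one]

theorem extOn_of_lt (h : i < j) :
    extOn hi hj f = X.unitsRes (le_inf hi hj) (f ⟨(i, j), h⟩) := by
  rw [extOn, ext_of_lt h]

theorem extOn_symm : extOn hj hi f = (extOn hi hj f)⁻¹ := by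
  rcases lt_trichotomy i j with h | rfl | h
  · rw [extOn, extOn, ext_of_gt h, ext_of_lt h, map_inv, X.unitsRes_res]
  · rw [extOn_self, inv_one]
  · rw [extOn, extOn, ext_of_gt h, ext_of_lt h, map_inv, X.unitsRes_res, inv_inv]

theorem extOn_res {W' : Opens X.carrier} (h : W' ≤ W) :
    X.unitsRes h (extOn hi hj f) = extOn (h.trans hi) (h.trans hj) f := by
  rw [extOn, extOn, X.unitsRes_res]

variable {f}

theorem extOn_mul_of_lt (hf : f ∈ 𝒰.Z1) (hij : i < j) (hjk : j < k) :
    extOn hi hj f * extOn hj hk f = extOn hi hk f := by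
  have h := congrArg (X.unitsRes (le_inf (le_inf hi hj) hk))
    (congrFun hf (⟨(i, j, k), hij, hjk⟩ : 𝒰.Triples))
  simp only [d1p, d1m, MonoidHom.coe_mk, OneHom.coe_mk, map_mul, X.unitsRes_res] at h
  rw [extOn_of_lt hi hj f hij, extOn_of_lt hj hk f hjk, extOn_of_lt hi hk f (hij.trans hjk),
    mul_comm]
  exact h

theorem extOn_mul (hf : f ∈ 𝒰.Z1) : extOn hi hj f * extOn hj hk f = extOn hi hk f := by
  rcases lt_trichotomy i j with hij | rfl | hij
  · rcases lt_trichotomy j k with hjk | rfl | hjk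
    · exact extOn_mul_of_lt hi hj hk hf hij hjk
    · rw [extOn_self, mul_one]
    · rw [extOn_symm hk hj, mul_inv_eq_iff_eq_mul]
      rcases lt_trichotomy i k with hik | rfl | hik
      · exact (extOn_mul_of_lt hi hk hj hf hik hjk).symm
      · rw [extOn_self, one_mul]
      · rw [extOn_symm hk hi, eq_inv_mul_iff_mul_eq]
        exact extOn_mul_of_lt hk hi hj hf hik hij
  · rw [extOn_self, one_mul]
  · rw [extOn_symm hj hi, inv_mul_eq_iff_eq_mul]
    rcases lt_trichotomy i k with hik | rfl | hik
    · exact (extOn_mul_of_lt hj hi hk hf hij hik).symm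
    · rw [extOn_self, mul_one]
    · rw [extOn_symm hk hi, eq_mul_inv_iff_mul_eq]
      rcases lt_trichotomy j k with hjk | rfl | hjk
      · exact extOn_mul_of_lt hj hk hi hf hjk hik
      · rw [extOn_self, one_mul]
      · rw [extOn_symm hk hj, inv_mul_eq_iff_eq_mul]
        exact (extOn_mul_of_lt hk hj hi hf hjk hij).symm

end extOn

variable (𝒰 𝒱) in
/-- The data of a refinement: `V_j ⊆ U_{σ(j)}`. -/
structure Refinement where
  σ : 𝒱.ι → 𝒰.ι
  le : ∀ j, 𝒱.set j ≤ 𝒰.set (σ j)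

namespace Refinement

variable {𝒲 : OpenCover X} (σ τ : Refinement 𝒰 𝒱)

/-- The map on `C⁰`: `σ(x)_j = x_{σ(j)}`. -/
def onC0 : 𝒰.C0 →* 𝒱.C0 where
  toFun x j := X.unitsRes (σ.le j) (x (σ.σ j))
  map_one' := funext fun _ => map_one _
  map_mul' _ _ := funext fun _ => map_mul _ _ _

/-- The map on `C¹`: `σ(x)_{jk} = x_{σ(j)σ(k)}`, with the convention that `x` is extended to all
pairs of indices as an alternating cochain. -/
def onC1 : 𝒰.C1 →* 𝒱.C1 where
  toFun x p := X.unitsRes (inf_le_inf (σ.le p.1.1) (σ.le p.1.2))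
    (𝒰.ext (σ.σ p.1.1) (σ.σ p.1.2) x)
  map_one' := funext fun _ => by rw [map_one, map_one]; rfl
  map_mul' _ _ := funext fun _ => by rw [map_mul, map_mul]; rfl

theorem onC1_apply (x : 𝒰.C1) (p : 𝒱.Pairs) : σ.onC1 x p =
    extOn (inf_le_left.trans (σ.le p.1.1)) (inf_le_right.trans (σ.le p.1.2)) x := rfl

theorem onC1_mem {x : 𝒰.C1} (hx : x ∈ 𝒰.Z1) : σ.onC1 x ∈ 𝒱.Z1 := by
  refine funext fun t => ?_
  simp only [d1p, d1m, MonoidHom.coe_mk, OneHom.coe_mk, onC1_apply, extOn_res]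
  rw [mul_comm]
  exact extOn_mul _ _ _ hx

theorem extOn_onC1 {W : Opens X.carrier} {j k : 𝒱.ι} (hj : W ≤ 𝒱.set j) (hk : W ≤ 𝒱.set k)
    (x : 𝒰.C1) : extOn hj hk (σ.onC1 x) = extOn (hj.trans (σ.le j)) (hk.trans (σ.le k)) x := by
  rcases lt_trichotomy j k with h | rfl | h
  · rw [extOn_of_lt _ _ _ h, onC1_apply, extOn_res]
  · rw [extOn_self, extOn_self]
  · rw [extOn_symm hk hj, extOn_of_lt _ _ _ h, onC1_apply, extOn_res, ← extOn_symm]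

theorem extOn_d0 {W : Opens X.carrier} {i j : 𝒰.ι} (hi : W ≤ 𝒰.set i) (hj : W ≤ 𝒰.set j)
    (w : 𝒰.C0) : extOn hi hj (𝒰.d0p w) * X.unitsRes hi (w i) =
      extOn hi hj (𝒰.d0m w) * X.unitsRes hj (w j) := by
  have key : ∀ {i j : 𝒰.ι} (hi : W ≤ 𝒰.set i) (hj : W ≤ 𝒰.set j), i < j →
      extOn hi hj (𝒰.d0p w) = X.unitsRes hj (w j) ∧
      extOn hi hj (𝒰.d0m w) = X.unitsRes hi (w i) := by
    intro i j hi hj h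
    rw [extOn_of_lt _ _ _ h, extOn_of_lt _ _ _ h]
    simp [d0p, d0m]
  rcases lt_trichotomy i j with h | rfl | h
  · rw [(key hi hj h).1, (key hi hj h).2, mul_comm]
  · rw [extOn_self, extOn_self]
  · rw [extOn_symm hj hi, extOn_symm hj hi, (key hj hi h).1, (key hj hi h).2, inv_mul_cancel,
      inv_mul_cancel]

/-- The map on cocycles. -/
def onZ1 : 𝒰.Z1 →* 𝒱.Z1 :=
  (σ.onC1.comp 𝒰.Z1.subtype).codRestrict 𝒱.Z1 fun x => σ.onC1_mem x.2

/-- The map `Ȟ¹(𝒰, 𝒪_X^*) → Ȟ¹(𝒱, 𝒪_X^*)` induced by a refinement. -/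
def onH1 : 𝒰.H1 →* 𝒱.H1 :=
  Con.lift _ ((Con.mk' _).comp σ.onZ1) (by
    intro x y h
    obtain ⟨w, h⟩ := (pairCon_iff _ _ _ x y).1 h
    refine (Con.eq _).2 ((pairCon_iff _ _ _ _ _).2 ⟨σ.onC0 w, ?_⟩)
    change σ.onC1 x * 𝒱.d0m (σ.onC0 w) = σ.onC1 y * 𝒱.d0p (σ.onC0 w)
    funext p
    have e := extOn_d0 (inf_le_left.trans (σ.le p.1.1) : 𝒱.inter₂ p.1.1 p.1.2 ≤ _)
      (inf_le_right.trans (σ.le p.1.2)) w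
    have e' := congrFun (congrArg σ.onC1 h) p
    rw [map_mul, map_mul, Pi.mul_apply, Pi.mul_apply, onC1_apply σ (𝒰.d0m w),
      onC1_apply σ (𝒰.d0p w)] at e'
    have a1 : 𝒱.d0m (σ.onC0 w) p =
        X.unitsRes (inf_le_left.trans (σ.le p.1.1)) (w (σ.σ p.1.1)) := by simp [d0m, onC0]
    have a2 : 𝒱.d0p (σ.onC0 w) p =
        X.unitsRes (inf_le_right.trans (σ.le p.1.2)) (w (σ.σ p.1.2)) := by simp [d0p, onC0]
    rw [Pi.mul_apply, Pi.mul_apply, a1, a2]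
    refine mul_right_cancel (b := extOn (inf_le_left.trans (σ.le p.1.1))
      (inf_le_right.trans (σ.le p.1.2)) (𝒰.d0m w)) ?_
    rw [mul_right_comm, e', mul_assoc, e, mul_assoc, mul_comm (X.unitsRes _ _)])

theorem onH1_mk (x : 𝒰.Z1) :
    σ.onH1 (x : 𝒰.H1) = ((σ.onZ1 x : 𝒱.Z1) : 𝒱.H1) := rfl

theorem onH1_eq : σ.onH1 = τ.onH1 := by
  refine MonoidHom.ext fun z => ?_
  induction z using Con.induction_on with
  | H x =>
    rw [onH1_mk, onH1_mk]
    refine (Con.eq _).2 ((pairCon_iff _ _ _ _ _).2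
      ⟨fun j => extOn (τ.le j) (σ.le j) x.1, ?_⟩)
    change σ.onC1 x * _ = τ.onC1 x * _
    funext p
    simp only [d0p, d0m, MonoidHom.coe_mk, OneHom.coe_mk, Pi.mul_apply, onC1_apply, extOn_res]
    rw [mul_comm, extOn_mul _ _ _ x.2, extOn_mul _ _ _ x.2]

variable (𝒰) in
/-- The identity refinement. -/
protected def id : Refinement 𝒰 𝒰 := ⟨fun i => i, fun _ => le_rfl⟩

/-- Composition of refinements. -/
protected def comp (τ : Refinement 𝒱 𝒲) : Refinement 𝒰 𝒲 :=
  ⟨fun k => σ.σ (τ.σ k), fun k => (τ.le k).trans (σ.le _)⟩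

theorem onH1_id (z : 𝒰.H1) : (Refinement.id 𝒰).onH1 z = z := by
  induction z using Con.induction_on with
  | H x =>
    rw [onH1_mk]
    congr 1
    refine Subtype.ext (funext fun p => ?_)
    change (Refinement.id 𝒰).onC1 x.1 p = _
    rw [onC1_apply]
    exact (extOn_of_lt _ _ _ p.2).trans (X.unitsRes_self _ _)

theorem onH1_comp (τ : Refinement 𝒱 𝒲) (z : 𝒰.H1) :
    (σ.comp τ).onH1 z = τ.onH1 (σ.onH1 z) := by
  induction z using Con.induction_on with
  | H x =>
    rw [onH1_mk, onH1_mk, onH1_mk]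
    congr 1
    refine Subtype.ext (funext fun p => ?_)
    change (σ.comp τ).onC1 x.1 p = τ.onC1 (σ.onC1 x.1) p
    rw [onC1_apply, onC1_apply, extOn_onC1]
    rfl

end Refinement

/-- Coverings are preordered by refinement: `𝒰 ≤ 𝒱` if `𝒱` refines `𝒰`. -/
instance : Preorder (OpenCover X) where
  le 𝒰 𝒱 := Nonempty (Refinement 𝒰 𝒱)
  le_refl 𝒰 := ⟨Refinement.id 𝒰⟩
  le_trans _ _ _ := fun ⟨σ⟩ ⟨τ⟩ => ⟨σ.comp τ⟩

instance : Nonempty (OpenCover X) :=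
  ⟨{ ι := PUnit, set := fun _ => ⊤, exists_mem := fun _ => ⟨PUnit.unit, trivial⟩ }⟩

instance : IsDirectedOrder (OpenCover X) where
  directed 𝒰 𝒱 := ⟨{ ι := 𝒰.ι ×ₗ 𝒱.ι
                     set := fun p => 𝒰.set (ofLex p).1 ⊓ 𝒱.set (ofLex p).2
                     exists_mem := fun x => by
                      obtain ⟨i, hi⟩ := 𝒰.exists_mem x
                      obtain ⟨j, hj⟩ := 𝒱.exists_mem x
                      exact ⟨toLex (i, j), hi, hj⟩ },
    ⟨⟨fun p => (ofLex p).1, fun _ => inf_le_left⟩⟩,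
    ⟨⟨fun p => (ofLex p).2, fun _ => inf_le_right⟩⟩⟩

/-- The canonical map `Ȟ¹(𝒰, 𝒪_X^*) → Ȟ¹(𝒱, 𝒪_X^*)` if `𝒱` refines `𝒰`; it does not depend on the
choice of a refinement map. -/
noncomputable def transition (𝒰 𝒱 : OpenCover X) (h : 𝒰 ≤ 𝒱) : 𝒰.H1 →* 𝒱.H1 :=
  (Classical.choice h).onH1

theorem transition_eq {𝒰 𝒱 : OpenCover X} (h : 𝒰 ≤ 𝒱) (σ : Refinement 𝒰 𝒱) :
    transition 𝒰 𝒱 h = σ.onH1 := Refinement.onH1_eq _ _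

instance : DirectedSystem (fun 𝒰 : OpenCover X => 𝒰.H1) (transition · · ·) where
  map_self 𝒰 z := by
    rw [transition_eq le_rfl (Refinement.id 𝒰), Refinement.onH1_id]
  map_map _ _ _ h h' z := by
    obtain ⟨σ⟩ := h
    obtain ⟨τ⟩ := h'
    rw [transition_eq _ σ, transition_eq _ τ, transition_eq _ (σ.comp τ), Refinement.onH1_comp]

end OpenCover

variable (X) in
/-- `Ȟ¹(X, 𝒪_X^*)`: the colimit of the groups `Ȟ¹(𝒰, 𝒪_X^*)` over the open coverings of `X`. -/
abbrev CechH1 : Type (u + 1) :=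
  DirectLimit (fun 𝒰 : OpenCover X => 𝒰.H1) OpenCover.transition

/-- The class in `Ȟ¹(X, 𝒪_X^*)` of a cocycle for an open covering. -/
noncomputable def OpenCover.cechClass (𝒰 : OpenCover X) (f : 𝒰.Z1) : CechH1 X :=
  Quotient.mk _ (Sigma.mk (β := fun 𝒰 : OpenCover X => 𝒰.H1) 𝒰 (f : 𝒰.H1))

end Cech

end SemiringGeometry

/-! An isomorphism `𝒪_X|_U ≅ L|_U` amounts to a section `e` of `L` over `U`, the image of `1`, such
that every section over every `V ⊆ U` is a unique multiple of `e|_V`. Two such generators `e`, `e'`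
differ by a unit: if `e = a e'` and `e' = b e`, then `ab e' = e'`, and uniqueness of coefficients
gives `ab = 1`. Neither subtraction nor ideals occur, so the classical argument for schemes carries
over to semirings.

Generators `e_i` over a covering therefore have unit transition functions, `e_i = f_ij e_j`, and
these form a cocycle (`IsFrame.mem_Z1`). Changing the generators moves `f` within its class modulo
`ρ` (`IsFrame.pairCon`), and refining the covering restricts `f` (`IsFrame.refine`), so the class in
the colimit depends only on the isomorphism class of `L`. Conversely, a cocycle glues copies of
`𝒪_X` to an invertible sheaf, `twistSheaf f`, and every sheaf with transition functions `f` is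
isomorphic to it (`IsFrame.isoTwist`). Both directions meet in `IsFrame.equiv_iff`, which yields the
bijection `picEquiv`.

If `e_i` generate `L` and `e'_i` generate `M`, then `e_i ⊗ e'_i` generate `L ⊗ M`, and the
transition functions multiply (`IsFrame.tensor`). The group structure of `Pic` is transported from
`Ȟ¹`, so associativity and inverses need no proof on the side of sheaves. -/

namespace SemiringGeometry

variable {X : SemiringedSpace.{u}}

/-! ## Generators of semimodules -/

namespace SemimodulePresheaf

variable {L : SemimodulePresheaf X} {U V : Opens X.carrier}

/-- A section `e` of `L` over `U` is a generator if `a ↦ a • e|_V` is bijective for all `V ⊆ U`. -/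
def IsGenerator (L : SemimodulePresheaf X) {U : Opens X.carrier} (e : L.obj U) : Prop :=
  ∀ (V : Opens X.carrier) (h : V ≤ U), Function.Bijective fun a : X.sec V => a • L.res h e

namespace IsGenerator

variable {e e' : L.obj U}

theorem res (he : L.IsGenerator e) (h : V ≤ U) : L.IsGenerator (L.res h e) := fun W hW => by
  simpa only [L.res_res] using he W (hW.trans h)

theorem smul_injective (he : L.IsGenerator e) : Function.Injective fun a : X.sec U => a • e := by
  simpa only [L.res_self] using (he U le_rfl).1

/-- The isomorphism `𝒪_X(V) ≅ L(V)` given by a generator over `U ⊇ V`. -/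
noncomputable def equiv (he : L.IsGenerator e) (h : V ≤ U) : X.sec V ≃ₗ[X.sec V] L.obj V :=
  LinearEquiv.ofBijective (LinearMap.toSpanSingleton (X.sec V) (L.obj V) (L.res h e)) (he V h)

theorem equiv_apply (he : L.IsGenerator e) (h : V ≤ U) (a : X.sec V) :
    he.equiv h a = a • L.res h e := rfl

theorem symm_smul (he : L.IsGenerator e) (h : V ≤ U) (s : L.obj V) :
    (he.equiv h).symm s • L.res h e = s := (he.equiv h).apply_symm_apply s

/-- Restricting `s = a • e` to `W` exhibits `a|_W` as a coefficient of `s|_W`, and coefficients are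
unique. -/
theorem symm_res (he : L.IsGenerator e) {W : Opens X.carrier} (h : V ≤ U) (h' : W ≤ V)
    (s : L.obj V) :
    (he.equiv (h'.trans h)).symm (L.res h' s) = X.res h' ((he.equiv h).symm s) := by
  rw [LinearEquiv.symm_apply_eq, equiv_apply]
  conv_lhs => rw [← he.symm_smul h s]
  rw [LinearMap.map_smulₛₗ, L.res_res]

/-- Each generator is a multiple of the other, and cancelling `e'` shows that the two coefficients
are mutually inverse. -/
theorem exists_unit (he : L.IsGenerator e) (he' : L.IsGenerator e') :
    ∃ a : X.units U, e = (a : X.sec U) • e' := by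
  obtain ⟨a, ha⟩ := (he' U le_rfl).2 e
  obtain ⟨b, hb⟩ := (he U le_rfl).2 e'
  simp only [L.res_self] at ha hb
  have hab : a * b = 1 := he'.smul_injective (by
    change (a * b) • e' = (1 : X.sec U) • e'
    rw [one_smul, mul_comm, mul_smul, ha, hb])
  exact ⟨⟨a, b, hab, by rw [mul_comm, hab]⟩, ha.symm⟩

theorem unit_smul (he : L.IsGenerator e) (w : X.units U) :
    L.IsGenerator ((w : X.sec U) • e) := fun V h => by
  have : (fun a : X.sec V => a • L.res h ((w : X.sec U) • e)) =
      (fun a : X.sec V => a • L.res h e) ∘ fun a => a * (X.unitsRes h w : X.sec V) := by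
    funext a
    simp [LinearMap.map_smulₛₗ, mul_smul]
  rw [this]
  exact (he V h).comp (Units.mulRight_bijective _)

end IsGenerator

end SemimodulePresheaf

/-- By naturality and linearity `a • φ(1)|_V = φ_V(a)`, so multiplication by the section is the
bijection `φ_V` itself. -/
theorem IsoOver.isGenerator {L : SemimodulePresheaf X} {U : Opens X.carrier}
    (φ : IsoOver U (structureSheaf X).toSemimodulePresheaf L) :
    L.IsGenerator (φ.equiv U le_rfl (1 : X.sec U)) := fun V h => by
  have : (fun a : X.sec V => a • L.res h (φ.equiv U le_rfl (1 : X.sec U))) = φ.equiv V h := by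
    funext a
    rw [← φ.naturality le_rfl h, ← LinearEquiv.map_smul]
    exact congrArg (φ.equiv V h) ((congrArg (a * ·) (map_one (X.res h))).trans (mul_one a))
  rw [this]
  exact (φ.equiv V h).bijective

/-- The isomorphism `𝒪_X|_U ≅ L|_U` sending `1` to a given generator. -/
noncomputable def SemimodulePresheaf.IsGenerator.isoOver {L : SemimodulePresheaf X}
    {U : Opens X.carrier} {e : L.obj U} (he : L.IsGenerator e) :
    IsoOver U (structureSheaf X).toSemimodulePresheaf L where
  equiv _ h := he.equiv h
  naturality {V W} hV h s := by
    rw [he.equiv_apply, he.equiv_apply, LinearMap.map_smulₛₗ, L.res_res]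
    rfl

theorem SemimodulePresheaf.IsGenerator.map {L M : SemimodulePresheaf X} {U : Opens X.carrier}
    {e : L.obj U} (he : L.IsGenerator e) (α : IsoOver ⊤ L M) :
    M.IsGenerator (α.equiv U le_top e) := fun V h => by
  have : (fun a : X.sec V => a • M.res h (α.equiv U le_top e)) =
      α.equiv V le_top ∘ fun a : X.sec V => a • L.res h e := by
    funext a
    rw [← α.naturality le_top h, ← LinearEquiv.map_smul]
    rfl
  rw [this]
  exact (α.equiv V le_top).bijective.comp (he V h)

theorem isGenerator_one (U : Opens X.carrier) :
    (structureSheaf X).IsGenerator (1 : X.sec U) := fun V h => by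
  have : (fun a : X.sec V => a • (structureSheaf X).res h (1 : X.sec U)) = id :=
    funext fun a => (congrArg (a * ·) (map_one (X.res h))).trans (mul_one a)
  rw [this]
  exact Function.bijective_id

/-! ### Generators of tensor products. -/

/-- The section `s ⊗ t` of `L ⊗ M`. -/
noncomputable def tensorSection (L M : SemimoduleSheaf X) {U : Opens X.carrier} (s : L.obj U)
    (t : M.obj U) : (tensorSheaf L M).obj U :=
  (tensorPresheaf L.toSemimodulePresheaf M.toSemimodulePresheaf).toSheafify U (s ⊗ₜ[X.sec U] t)

theorem res_tensorSection (L M : SemimoduleSheaf X) {U V : Opens X.carrier} (h : V ≤ U)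
    (s : L.obj U) (t : M.obj U) : (tensorSheaf L M).res h (tensorSection L M s t) =
      tensorSection L M (L.res h s) (M.res h t) :=
  Subtype.ext (funext fun x =>
    (SemimodulePresheaf.germ_res
      (P := tensorPresheaf L.toSemimodulePresheaf M.toSemimodulePresheaf) h x.2 (s ⊗ₜ t)).symm)

theorem tensorSection_smul (L M : SemimoduleSheaf X) {U : Opens X.carrier} (a b : X.sec U)
    (s : L.obj U) (t : M.obj U) :
    tensorSection L M (a • s) (b • t) = (a * b) • tensorSection L M s t := by
  rw [tensorSection, TensorProduct.smul_tmul_smul]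
  exact map_smul ((tensorPresheaf L.toSemimodulePresheaf M.toSemimodulePresheaf).toSheafify U)
    (a * b) (s ⊗ₜ[X.sec U] t)

/-- The generators give isomorphisms with `𝒪_X` over `U`. Their tensor product, followed by
sheafification, is an isomorphism `𝒪_X|_U ≅ (L ⊗ M)|_U` whose value at `1` is `s ⊗ t`, so no stalk
has to be computed. -/
theorem SemimodulePresheaf.IsGenerator.tensor {L M : SemimoduleSheaf X} {U : Opens X.carrier}
    {s : L.obj U} {t : M.obj U} (hs : L.IsGenerator s) (ht : M.IsGenerator t) :
    (tensorSheaf L M).IsGenerator (tensorSection L M s t) := by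
  have h := ((hs.isoOver.tensor ht.isoOver).sheafify).isGenerator
  have e : (hs.isoOver.tensor ht.isoOver).sheafify.equiv U le_rfl (1 : X.sec U) =
      tensorSection L M s t := by
    have h1 : hs.isoOver.equiv U le_rfl (1 : X.sec U) = s := by
      change (1 : X.sec U) • L.res le_rfl s = s
      rw [one_smul, L.res_self]
    have h2 : ht.isoOver.equiv U le_rfl (1 : X.sec U) = t := by
      change (1 : X.sec U) • M.res le_rfl t = t
      rw [one_smul, M.res_self]
    exact congrArg₂ (tensorSection L M) h1 h2
  rwa [e] at h

/-! ## Frames and transition functions -/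

namespace OpenCover

variable {𝒰 𝒱 : OpenCover X}

/-- The `e_i` are generators of `L` over the members of a covering, and `e_i = f_ij e_j` for
`i < j`. -/
structure IsFrame (𝒰 : OpenCover X) (L : SemimodulePresheaf X) (e : ∀ i, L.obj (𝒰.set i))
    (f : 𝒰.C1) : Prop where
  gen : ∀ i, L.IsGenerator (e i)
  transition : ∀ p : 𝒰.Pairs, L.res inf_le_left (e p.1.1) =
    (f p : X.sec (𝒰.inter₂ p.1.1 p.1.2)) • L.res inf_le_right (e p.1.2)

theorem exists_isFrame {L : SemimodulePresheaf X} {e : ∀ i, L.obj (𝒰.set i)}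
    (he : ∀ i, L.IsGenerator (e i)) : ∃ f, 𝒰.IsFrame L e f := by
  choose f hf using fun p : 𝒰.Pairs =>
    ((he p.1.1).res (inf_le_left : 𝒰.inter₂ p.1.1 p.1.2 ≤ _)).exists_unit
      ((he p.1.2).res inf_le_right)
  exact ⟨f, he, hf⟩

namespace IsFrame

variable {L M : SemimodulePresheaf X} {e e' : ∀ i, L.obj (𝒰.set i)} {f g : 𝒰.C1}

/-- The alternating convention is the one for which `e_i = f_ij e_j` holds for all pairs of indices.
This is needed because refinement maps do not preserve the order. -/
theorem extOn_smul (H : 𝒰.IsFrame L e f) {W : Opens X.carrier} {i j : 𝒰.ι} (hi : W ≤ 𝒰.set i)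
    (hj : W ≤ 𝒰.set j) : L.res hi (e i) = (extOn hi hj f : X.sec W) • L.res hj (e j) := by
  have key : ∀ {i j : 𝒰.ι} (hi : W ≤ 𝒰.set i) (hj : W ≤ 𝒰.set j), i < j →
      L.res hi (e i) = (extOn hi hj f : X.sec W) • L.res hj (e j) := by
    intro i j hi hj h
    have := congrArg (L.res (le_inf hi hj)) (H.transition ⟨(i, j), h⟩)
    rw [LinearMap.map_smulₛₗ, L.res_res, L.res_res] at this
    rw [extOn_of_lt _ _ _ h]
    exact this
  rcases lt_trichotomy i j with h | rfl | h
  · exact key hi hj h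
  · rw [extOn_self, Units.val_one, one_smul]
  · rw [key hj hi h, extOn_symm hj hi, smul_smul, Units.inv_mul, one_smul]

/-- On `U_ijk` both `f_jk f_ij` and `f_ik` are the coefficient of `e_i` with respect to the
generator `e_k`. -/
theorem mem_Z1 (H : 𝒰.IsFrame L e f) : f ∈ 𝒰.Z1 := by
  refine funext fun t => Units.ext ?_
  have hi : 𝒰.inter₃ t.1.1 t.1.2.1 t.1.2.2 ≤ 𝒰.set t.1.1 := inf_le_left.trans inf_le_left
  have hj : 𝒰.inter₃ t.1.1 t.1.2.1 t.1.2.2 ≤ 𝒰.set t.1.2.1 := inf_le_left.trans inf_le_right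
  have hk : 𝒰.inter₃ t.1.1 t.1.2.1 t.1.2.2 ≤ 𝒰.set t.1.2.2 := inf_le_right
  have e1 : 𝒰.d1p f t = extOn hj hk f * extOn hi hj f := by
    rw [extOn_of_lt _ _ _ t.2.1, extOn_of_lt _ _ _ t.2.2]; rfl
  have e2 : 𝒰.d1m f t = extOn hi hk f := by
    rw [extOn_of_lt _ _ _ (t.2.1.trans t.2.2)]; rfl
  refine ((H.gen t.1.2.2).res hk).smul_injective ?_
  change (𝒰.d1p f t : X.sec (𝒰.inter₃ t.1.1 t.1.2.1 t.1.2.2)) • L.res hk _ =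
    (𝒰.d1m f t : X.sec (𝒰.inter₃ t.1.1 t.1.2.1 t.1.2.2)) • L.res hk _
  rw [e1, e2, ← H.extOn_smul, mul_comm, Units.val_mul, mul_smul, ← H.extOn_smul, ← H.extOn_smul]

theorem refine (H : 𝒰.IsFrame L e f) (σ : Refinement 𝒰 𝒱) :
    𝒱.IsFrame L (fun j => L.res (σ.le j) (e (σ.σ j))) (σ.onC1 f) where
  gen j := (H.gen _).res _
  transition p := by
    rw [L.res_res, L.res_res, Refinement.onC1_apply]
    exact H.extOn_smul _ _

theorem map (H : 𝒰.IsFrame L e f) (α : IsoOver ⊤ L M) :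
    𝒰.IsFrame M (fun i => α.equiv _ le_top (e i)) f where
  gen i := (H.gen i).map α
  transition p := by
    rw [← α.naturality le_top, ← α.naturality le_top, H.transition, LinearEquiv.map_smul]

/-- `w_i e_i = w_i f_ij e_j = g_ij w_j e_j`. Thus every cocycle equivalent to `f` is realised by a
frame of the same sheaf. -/
theorem smul (H : 𝒰.IsFrame L e f) (w : 𝒰.C0) (h : f * 𝒰.d0m w = g * 𝒰.d0p w) :
    𝒰.IsFrame L (fun i => (w i : X.sec (𝒰.set i)) • e i) g where
  gen i := (H.gen i).unit_smul (w i)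
  transition p := by
    have h' := congrArg Units.val (congrFun h p)
    simp only [Pi.mul_apply, Units.val_mul] at h'
    rw [LinearMap.map_smulₛₗ, LinearMap.map_smulₛₗ, H.transition, smul_smul, smul_smul, mul_comm]
    exact congrArg (· • L.res inf_le_right (e p.1.2)) h'

/-- With `e'_i = w_i e_i`, the relation `e'_i = g_ij e'_j` becomes `w_i f_ij e_j = g_ij w_j e_j`,
and `e_j` cancels. -/
theorem pairCon (H : 𝒰.IsFrame L e f) (H' : 𝒰.IsFrame L e' g) :
    ∃ w : 𝒰.C0, f * 𝒰.d0m w = g * 𝒰.d0p w := by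
  choose w hw using fun i => (H'.gen i).exists_unit (H.gen i)
  refine ⟨w, funext fun p => Units.ext (((H.gen p.1.2).res inf_le_right).smul_injective ?_)⟩
  have h := H'.transition p
  rw [hw, hw, LinearMap.map_smulₛₗ, LinearMap.map_smulₛₗ, H.transition, smul_smul, smul_smul] at h
  simp only [Pi.mul_apply, Units.val_mul]
  rw [mul_comm]
  exact h

theorem tensor {L M : SemimoduleSheaf X} {e : ∀ i, L.obj (𝒰.set i)}
    {e' : ∀ i, M.obj (𝒰.set i)} (H : 𝒰.IsFrame L.toSemimodulePresheaf e f)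
    (H' : 𝒰.IsFrame M.toSemimodulePresheaf e' g) :
    𝒰.IsFrame (tensorSheaf L M).toSemimodulePresheaf (fun i => tensorSection L M (e i) (e' i))
      (f * g) where
  gen i := (H.gen i).tensor (H'.gen i)
  transition p := by
    rw [res_tensorSection, res_tensorSection, H.transition, H'.transition, tensorSection_smul]
    rfl

end IsFrame

theorem isFrame_one (𝒰 : OpenCover X) :
    𝒰.IsFrame (structureSheaf X).toSemimodulePresheaf (fun i => (1 : X.sec (𝒰.set i))) 1 where
  gen i := isGenerator_one _
  transition p := by
    rw [Pi.one_apply, Units.val_one, one_smul]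
    exact (map_one (X.res _)).trans (map_one (X.res _)).symm

end OpenCover

/-- An invertible sheaf has a frame over some covering. -/
theorem IsInvertible.exists_isFrame {L : SemimoduleSheaf X} (hL : IsInvertible L) :
    ∃ (𝒰 : OpenCover X) (e : ∀ i, L.obj (𝒰.set i)) (f : 𝒰.C1),
      𝒰.IsFrame L.toSemimodulePresheaf e f := by
  choose U hU φ using hL
  -- The covering is indexed by the points of `X`. A cover needs a totally ordered index set, so an
  -- arbitrary well-ordering is chosen.
  let _ : LinearOrder X.carrier := IsWellOrder.linearOrder WellOrderingRel
  let 𝒰 : OpenCover X := ⟨X.carrier, U, fun x => ⟨x, hU x⟩⟩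
  obtain ⟨f, hf⟩ := OpenCover.exists_isFrame (𝒰 := 𝒰) (L := L.toSemimodulePresheaf)
    fun x => (φ x).some.isGenerator
  exact ⟨𝒰, _, f, hf⟩
namespace OpenCover

variable {𝒰 𝒱 : OpenCover X}

/-! ## The invertible sheaf glued from a cocycle -/

/-- Sections over `V` of the sheaf glued from a cochain `f`: the families of `s_i ∈ 𝒪_X(V ∩ U_i)`
with `s_i f_ij = s_j`. -/
def twistSections (f : 𝒰.C1) (V : Opens X.carrier) : AddSubmonoid (∀ i, X.sec (V ⊓ 𝒰.set i)) where
  -- `s_i` stands for the coefficient of `e_i`, and `s_i e_i = s_i f_ij e_j`. Letting `W` be any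
  -- open subset of the overlap avoids identifying different forms of the same intersection.
  carrier := {s | ∀ (i j : 𝒰.ι) (W : Opens X.carrier) (hi : W ≤ V ⊓ 𝒰.set i)
    (hj : W ≤ V ⊓ 𝒰.set j), X.res hi (s i) *
      extOn (hi.trans inf_le_right) (hj.trans inf_le_right) f = X.res hj (s j)}
  add_mem' hs ht i j W hi hj := by
    rw [Pi.add_apply, Pi.add_apply, map_add, map_add, add_mul, hs i j W hi hj, ht i j W hi hj]
  zero_mem' i j W hi hj := by
    rw [Pi.zero_apply, Pi.zero_apply, map_zero, map_zero, zero_mul]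

instance (f : 𝒰.C1) (V : Opens X.carrier) : SMul (X.sec V) (twistSections f V) where
  smul a s := ⟨fun i => X.res inf_le_left a * s.1 i, fun i j W hi hj => by
    rw [map_mul, map_mul, X.res_res, X.res_res, mul_assoc, s.2 i j W hi hj]⟩

theorem twist_smul_apply (f : 𝒰.C1) {V : Opens X.carrier} (a : X.sec V) (s : twistSections f V)
    (i : 𝒰.ι) : (a • s).1 i = X.res inf_le_left a * s.1 i := rfl

theorem twist_ext {f : 𝒰.C1} {V : Opens X.carrier} {s t : twistSections f V}
    (h : ∀ i, s.1 i = t.1 i) : s = t := Subtype.ext (funext h)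

instance (f : 𝒰.C1) (V : Opens X.carrier) : Module (X.sec V) (twistSections f V) where
  one_smul s := twist_ext fun i => by rw [twist_smul_apply, map_one, one_mul]
  mul_smul a b s := twist_ext fun i => by
    simp only [twist_smul_apply, map_mul, mul_assoc]
  smul_zero a := twist_ext fun i => mul_zero _
  smul_add a s t := twist_ext fun i => mul_add _ _ _
  add_smul a b s := twist_ext fun i => by
    rw [twist_smul_apply, map_add, add_mul]; rfl
  zero_smul s := twist_ext fun i => by
    rw [twist_smul_apply, map_zero, zero_mul]; rfl

/-- The sheaf glued from a cochain. -/
noncomputable def twistSheaf (f : 𝒰.C1) : SemimoduleSheaf X where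
  obj V := twistSections f V
  res {V W} h :=
    { toFun := fun s => ⟨fun i => X.res (inf_le_inf_right _ h) (s.1 i), fun i j N hi hj => by
        rw [X.res_res, X.res_res]
        exact s.2 i j N _ _⟩
      map_add' := fun s t => twist_ext fun i => map_add _ _ _
      map_smul' := fun a s => twist_ext fun i => by
        rw [twist_smul_apply]
        simp only [twist_smul_apply, map_mul, X.res_res] }
  res_self h s := twist_ext fun i => X.res_self _ _
  res_res h h' s := twist_ext fun i => X.res_res _ _ _
  eq_of_locally_eq {U} s t H := twist_ext fun i => X.eq_of_locally_eq _ _ fun x hx => by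
    obtain ⟨V, h, hV, e⟩ := H x hx.1
    exact ⟨V ⊓ 𝒰.set i, inf_le_inf_right _ h, ⟨hV, hx.2⟩, congrFun (congrArg Subtype.val e) i⟩
  exists_glue {κ} U s H := by
    have hs : ∀ (k l : κ) (i : 𝒰.ι) (W : Opens X.carrier) (hk : W ≤ U k ⊓ 𝒰.set i)
        (hl : W ≤ U l ⊓ 𝒰.set i), X.res hk ((s k).1 i) = X.res hl ((s l).1 i) := by
      intro k l i W hk hl
      have := congrArg (X.res (le_inf (le_inf (hk.trans inf_le_left) (hl.trans inf_le_left))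
        (hk.trans inf_le_right) : W ≤ U k ⊓ U l ⊓ 𝒰.set i))
        (congrFun (congrArg Subtype.val (H k l)) i)
      simpa using this
    have hU : ∀ i, iSup U ⊓ 𝒰.set i ≤ ⨆ k, U k ⊓ 𝒰.set i := fun i => (iSup_inf_eq _ _).le
    -- For each fixed `i` the `i`-th components are sections of `𝒪_X` and glue there. The twisting
    -- relation between the glued components is then checked locally on the `U k`.
    choose t ht using fun i => X.exists_glue (fun k => U k ⊓ 𝒰.set i) (fun k => (s k).1 i)
      fun k l => hs k l i _ _ _
    have ht' : ∀ (i : 𝒰.ι) (k : κ) (W : Opens X.carrier) (h : W ≤ ⨆ k, U k ⊓ 𝒰.set i)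
        (hk : W ≤ U k ⊓ 𝒰.set i), X.res h (t i) = X.res hk ((s k).1 i) := by
      intro i k W h hk
      rw [← ht i k, X.res_res]
    refine ⟨⟨fun i => X.res (hU i) (t i), fun i j W hi hj => ?_⟩, fun k => twist_ext fun i => ?_⟩
    · refine X.eq_of_locally_eq _ _ fun x hx => ?_
      obtain ⟨k, hk⟩ := Opens.mem_iSup.1 (hi hx).1
      refine ⟨W ⊓ U k, inf_le_left, ⟨hx, hk⟩, ?_⟩
      have hik : W ⊓ U k ≤ U k ⊓ 𝒰.set i :=
        le_inf inf_le_right (inf_le_left.trans (hi.trans inf_le_right))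
      have hjk : W ⊓ U k ≤ U k ⊓ 𝒰.set j :=
        le_inf inf_le_right (inf_le_left.trans (hj.trans inf_le_right))
      rw [map_mul, X.res_res, X.res_res, X.res_res, X.res_res, ht' i k _ _ hik, ht' j k _ _ hjk,
        ← X.coe_unitsRes, extOn_res]
      exact (s k).2 i j _ hik hjk
    · change X.res _ (X.res (hU i) (t i)) = _
      rw [X.res_res, ht' i k _ _ le_rfl, X.res_self]

/-- The sections `e_i` of the sheaf glued from a cocycle, with components `f_ik`. -/
def twistFrame {f : 𝒰.C1} (hf : f ∈ 𝒰.Z1) (i : 𝒰.ι) : (twistSheaf f).obj (𝒰.set i) :=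
  ⟨fun k => (𝒰.ext i k f : X.sec (𝒰.set i ⊓ 𝒰.set k)), fun j k W hj hk => by
    have := extOn_mul (hj.trans inf_le_left) (hj.trans inf_le_right) (hk.trans inf_le_right) hf
    exact congrArg Units.val this⟩

/-- As `f_ii = 1`, the `i`-th component of `a • e_i` is `a`, which gives injectivity. Over `V ⊆ U_i`
a section `s` is determined by `s_i`, because `s_k = s_i f_ik`; hence `s = s_i • e_i`. The
transition rule is the cocycle identity `f_ik = f_ij f_jk`. -/
theorem isFrame_twistFrame {f : 𝒰.C1} (hf : f ∈ 𝒰.Z1) :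
    𝒰.IsFrame (twistSheaf f).toSemimodulePresheaf (twistFrame hf) f where
  gen i V h := by
    have hV : V ≤ V ⊓ 𝒰.set i := le_inf le_rfl h
    constructor
    · intro a b hab
      have h1 : X.res inf_le_left a * X.res _ (𝒰.ext i i f : X.sec (𝒰.set i ⊓ 𝒰.set i)) =
          X.res inf_le_left b * X.res (inf_le_inf_right _ h)
            (𝒰.ext i i f : X.sec (𝒰.set i ⊓ 𝒰.set i)) :=
        congrFun (congrArg Subtype.val hab) i
      rw [ext_self, Units.val_one, map_one, mul_one, mul_one] at h1
      simpa using congrArg (X.res hV) h1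
    · intro s
      refine ⟨X.res hV (s.1 i), twist_ext fun k => ?_⟩
      have := s.2 i k (V ⊓ 𝒰.set k) (inf_le_left.trans hV) le_rfl
      rw [X.res_self] at this
      refine Eq.trans ?_ this
      change X.res _ (X.res hV (s.1 i)) * _ = _
      rw [X.res_res]
      rfl
  transition p := twist_ext fun k => by
    change X.res _ (𝒰.ext p.1.1 k f : X.sec (𝒰.set p.1.1 ⊓ 𝒰.set k)) = X.res inf_le_left
      (f p : X.sec (𝒰.inter₂ p.1.1 p.1.2)) *
      X.res _ (𝒰.ext p.1.2 k f : X.sec (𝒰.set p.1.2 ⊓ 𝒰.set k))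
    have := extOn_mul (W := 𝒰.inter₂ p.1.1 p.1.2 ⊓ 𝒰.set k) (inf_le_left.trans inf_le_left)
      (inf_le_left.trans inf_le_right) inf_le_right hf
    rw [extOn_of_lt _ _ _ p.2] at this
    exact (congrArg Units.val this).symm

theorem isInvertible_twistSheaf {f : 𝒰.C1} (hf : f ∈ 𝒰.Z1) : IsInvertible (twistSheaf f) :=
  fun x => by
    obtain ⟨i, hi⟩ := 𝒰.exists_mem x
    exact ⟨𝒰.set i, hi, ⟨((isFrame_twistFrame hf).gen i).isoOver⟩⟩

/-! ### Coordinates with respect to a frame. -/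

namespace IsFrame

variable {L : SemimoduleSheaf X} {e : ∀ i, L.obj (𝒰.set i)} {f : 𝒰.C1}

/-- The components of a section with respect to a frame. -/
noncomputable def coords (H : 𝒰.IsFrame L.toSemimodulePresheaf e f) (V : Opens X.carrier) :
    L.obj V →ₗ[X.sec V] (twistSheaf f).obj V where
  toFun s := ⟨fun i => ((H.gen i).equiv inf_le_right).symm (L.res inf_le_left s),
    fun i j W hi hj => by
      rw [← (H.gen i).symm_res, ← (H.gen j).symm_res, L.res_res, L.res_res]
      -- After multiplication by `e_j` both sides are the restriction of `s`: `s_i f_ij e_j = s_i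
      -- e_i = s = s_j e_j`.
      apply ((H.gen j).res (hj.trans inf_le_right)).smul_injective
      change (_ * _) • L.res _ (e j) = _ • L.res _ (e j)
      rw [mul_smul, ← H.extOn_smul (hi.trans inf_le_right), (H.gen i).symm_smul,
        (H.gen j).symm_smul]⟩
  map_add' s t := twist_ext fun i => by
    exact (congrArg ((H.gen i).equiv inf_le_right).symm (map_add (L.res inf_le_left) s t)).trans
      (map_add _ _ _)
  map_smul' a s := twist_ext fun i => by
    exact (congrArg ((H.gen i).equiv inf_le_right).symm
      (LinearMap.map_smulₛₗ (L.res inf_le_left) a s)).trans (LinearEquiv.map_smul _ _ _)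

theorem coords_smul (H : 𝒰.IsFrame L.toSemimodulePresheaf e f) {V : Opens X.carrier}
    (s : L.obj V) (i : 𝒰.ι) :
    (H.coords V s).1 i • L.res (inf_le_right : V ⊓ 𝒰.set i ≤ _) (e i) = L.res inf_le_left s :=
  (H.gen i).symm_smul _ _

/-- The coordinates determine a section on each `V ∩ U_i`. Conversely, the twisting relation says
that the local sections `a_i e_i` agree on overlaps, so they glue. -/
theorem coords_bijective (H : 𝒰.IsFrame L.toSemimodulePresheaf e f) (V : Opens X.carrier) :
    Function.Bijective (H.coords V) := by
  constructor
  · intro s t h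
    refine L.eq_of_locally_eq _ _ fun x hx => ?_
    obtain ⟨i, hi⟩ := 𝒰.exists_mem x
    refine ⟨V ⊓ 𝒰.set i, inf_le_left, ⟨hx, hi⟩, ?_⟩
    rw [← H.coords_smul, ← H.coords_smul, h]
  · intro a
    obtain ⟨t, ht⟩ := L.exists_glue (fun i => V ⊓ 𝒰.set i)
      (fun i => a.1 i • L.res (inf_le_right : V ⊓ 𝒰.set i ≤ _) (e i)) fun i j => by
        rw [LinearMap.map_smulₛₗ, LinearMap.map_smulₛₗ, L.res_res, L.res_res,
          H.extOn_smul _ (inf_le_right.trans inf_le_right), smul_smul,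
          a.2 i j _ inf_le_left inf_le_right]
    have hV : V ≤ ⨆ i, V ⊓ 𝒰.set i := fun x hx => by
      obtain ⟨i, hi⟩ := 𝒰.exists_mem x
      exact Opens.mem_iSup.2 ⟨i, hx, hi⟩
    refine ⟨L.res hV t, twist_ext fun i => ?_⟩
    change ((H.gen i).equiv inf_le_right).symm (L.res inf_le_left (L.res hV t)) = _
    rw [LinearEquiv.symm_apply_eq, L.res_res, ht]
    rfl

/-- A sheaf with a frame is isomorphic to the sheaf glued from the transition functions. -/
noncomputable def isoTwist (H : 𝒰.IsFrame L.toSemimodulePresheaf e f) :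
    IsoOver ⊤ L.toSemimodulePresheaf (twistSheaf f).toSemimodulePresheaf where
  equiv V _ := LinearEquiv.ofBijective (H.coords V) (H.coords_bijective V)
  naturality {V W} _ h s := twist_ext fun i => by
    change ((H.gen i).equiv _).symm (L.res _ (L.res h s)) =
      X.res (inf_le_inf_right _ h) (((H.gen i).equiv _).symm (L.res _ s))
    rw [← (H.gen i).symm_res, L.res_res, L.res_res]

end IsFrame

/-! ## The class of an invertible sheaf -/

theorem mk_eq_mk_iff (x y : 𝒰.Z1) :
    (x : 𝒰.H1) = y ↔ ∃ w : 𝒰.C0, (x : 𝒰.C1) * 𝒰.d0m w = y * 𝒰.d0p w :=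
  (Con.eq _).trans (pairCon_iff _ _ _ _ _)

/-- The transition maps of the colimit rest on chosen refinements; since any refinement induces the
same map on `Ȟ¹`, the choice can be replaced by explicit `σ` and `τ`. -/
theorem cechClass_eq_iff (x : 𝒰.Z1) (y : 𝒱.Z1) : 𝒰.cechClass x = 𝒱.cechClass y ↔
    ∃ (𝒲 : OpenCover X) (σ : Refinement 𝒰 𝒲) (τ : Refinement 𝒱 𝒲),
      σ.onH1 (x : 𝒰.H1) = τ.onH1 (y : 𝒱.H1) := by
  constructor
  · intro h
    obtain ⟨𝒲, ⟨σ⟩, ⟨τ⟩, e⟩ := Quotient.exact h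
    exact ⟨𝒲, σ, τ, by rwa [transition_eq _ σ, transition_eq _ τ] at e⟩
  · rintro ⟨𝒲, σ, τ, e⟩
    refine Quotient.sound ⟨𝒲, ⟨σ⟩, ⟨τ⟩, ?_⟩
    rwa [transition_eq _ σ, transition_eq _ τ]

theorem cechClass_mul (x y : 𝒰.Z1) : 𝒰.cechClass (x * y) = 𝒰.cechClass x * 𝒰.cechClass y :=
  (DirectLimit.mul_def (G := fun 𝒰 : OpenCover X => 𝒰.H1) (f := transition) 𝒰
    (x : 𝒰.H1) (y : 𝒰.H1)).symm

theorem cechClass_one (𝒰 : OpenCover X) : 𝒰.cechClass 1 = 1 :=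
  (DirectLimit.one_def (G := fun 𝒰 : OpenCover X => 𝒰.H1) (f := transition) 𝒰).symm

theorem cechClass_onZ1 (σ : Refinement 𝒰 𝒱) (x : 𝒰.Z1) :
    𝒱.cechClass (σ.onZ1 x) = 𝒰.cechClass x :=
  (cechClass_eq_iff _ _).2 ⟨𝒱, Refinement.id 𝒱, σ, by rw [Refinement.onH1_id]; rfl⟩

/-- Sheaves with frames are isomorphic if and only if their transition functions have the same
class in `Ȟ¹(X, 𝒪_X^*)`. -/
theorem IsFrame.equiv_iff {L M : InvertibleSheaf X} {e : ∀ i, L.1.obj (𝒰.set i)}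
    {e' : ∀ i, M.1.obj (𝒱.set i)} {f : 𝒰.Z1} {g : 𝒱.Z1}
    (H : 𝒰.IsFrame L.1.toSemimodulePresheaf e f)
    (H' : 𝒱.IsFrame M.1.toSemimodulePresheaf e' g) : L ≈ M ↔ 𝒰.cechClass f = 𝒱.cechClass g := by
  rw [cechClass_eq_iff]
  simp only [Refinement.onH1_mk, mk_eq_mk_iff]
  constructor
  · rintro ⟨α⟩
    obtain ⟨𝒲, ⟨σ⟩, ⟨τ⟩⟩ := exists_ge_ge 𝒰 𝒱
    -- Transport along `α` and passage to a common refinement give two frames of the one sheaf `M`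
    -- over `𝒲`.
    exact ⟨𝒲, σ, τ, ((H.map α).refine σ).pairCon (H'.refine τ)⟩
  · rintro ⟨𝒲, σ, τ, w, hw⟩
    -- Rescaling the refined frame of `L` by `w` makes its transition functions equal to those of
    -- `M`, so `L` and `M` are both isomorphic to the sheaf glued from them.
    let T : InvertibleSheaf X := ⟨twistSheaf (τ.onC1 g), isInvertible_twistSheaf (τ.onC1_mem g.2)⟩
    have hL : L ≈ T := ⟨((H.refine σ).smul w hw).isoTwist⟩
    have hM : M ≈ T := ⟨(H'.refine τ).isoTwist⟩
    exact Setoid.trans hL (Setoid.symm hM)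

end OpenCover

/-! ### The Čech class as a complete, multiplicative invariant. -/

namespace InvertibleSheaf

theorem exists_isFrame_class (L : InvertibleSheaf X) :
    ∃ (c : CechH1 X) (𝒰 : OpenCover X) (e : ∀ i, L.1.obj (𝒰.set i)) (f : 𝒰.Z1),
      𝒰.IsFrame L.1.toSemimodulePresheaf e f ∧ 𝒰.cechClass f = c := by
  obtain ⟨𝒰, e, f, H⟩ := L.2.exists_isFrame
  exact ⟨_, 𝒰, e, ⟨f, H.mem_Z1⟩, H, rfl⟩

/-- The class in `Ȟ¹(X, 𝒪_X^*)` of the transition functions of an invertible sheaf. -/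
noncomputable def cechClass (L : InvertibleSheaf X) : CechH1 X :=
  L.exists_isFrame_class.choose

/-- Independence of the chosen frame is `IsFrame.equiv_iff` applied to `L ≈ L` with two frames. -/
theorem cechClass_eq {L : InvertibleSheaf X} {𝒰 : OpenCover X} {e : ∀ i, L.1.obj (𝒰.set i)}
    {f : 𝒰.Z1} (H : 𝒰.IsFrame L.1.toSemimodulePresheaf e f) : L.cechClass = 𝒰.cechClass f := by
  obtain ⟨𝒱, e', g, H', h⟩ := L.exists_isFrame_class.choose_spec
  exact h.symm.trans ((H'.equiv_iff H).1 (Setoid.refl L))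

theorem equiv_iff (L M : InvertibleSheaf X) : L ≈ M ↔ L.cechClass = M.cechClass := by
  obtain ⟨𝒰, e, f, H, h⟩ := L.exists_isFrame_class.choose_spec
  obtain ⟨𝒱, e', g, H', h'⟩ := M.exists_isFrame_class.choose_spec
  rw [cechClass_eq H, cechClass_eq H', ← H.equiv_iff H']

/-- Every element of the colimit comes from a cocycle on some covering, and the sheaf glued from it
has that cocycle as transition functions. -/
theorem cechClass_surjective : Function.Surjective (cechClass (X := X)) := by
  intro z
  obtain ⟨𝒰, y, rfl⟩ := DirectLimit.exists_eq_mk _ z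
  induction y using Con.induction_on with
  | H f =>
    exact ⟨⟨OpenCover.twistSheaf f.1, OpenCover.isInvertible_twistSheaf f.2⟩,
      cechClass_eq (OpenCover.isFrame_twistFrame f.2)⟩

theorem cechClass_unit : (unit X).cechClass = 1 := by
  obtain ⟨𝒰⟩ : Nonempty (OpenCover X) := inferInstance
  rw [← OpenCover.cechClass_one 𝒰]
  exact cechClass_eq (f := 1) 𝒰.isFrame_one

/-- Frames of `L` and `M` are restricted to a common refinement, where their tensor product is a
frame with transition functions the product. -/
theorem cechClass_tensor (L M : InvertibleSheaf X) :
    (L.tensor M).cechClass = L.cechClass * M.cechClass := by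
  obtain ⟨𝒰, e, f, H, -⟩ := L.exists_isFrame_class.choose_spec
  obtain ⟨𝒱, e', g, H', -⟩ := M.exists_isFrame_class.choose_spec
  obtain ⟨𝒲, ⟨σ⟩, ⟨τ⟩⟩ := exists_ge_ge 𝒰 𝒱
  rw [cechClass_eq H, cechClass_eq H', ← OpenCover.cechClass_onZ1 σ, ← OpenCover.cechClass_onZ1 τ,
    ← OpenCover.cechClass_mul]
  exact cechClass_eq (L := L.tensor M) (f := σ.onZ1 f * τ.onZ1 g)
    ((H.refine σ).tensor (H'.refine τ))

end InvertibleSheaf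

variable (X) in
/-- The bijection `Pic(X) → Ȟ¹(X, 𝒪_X^*)`. -/
noncomputable def picEquiv : Pic X ≃ CechH1 X :=
  Equiv.ofBijective
    (Quotient.lift InvertibleSheaf.cechClass fun L M => (InvertibleSheaf.equiv_iff L M).1)
    ⟨fun p q => Quotient.inductionOn₂ p q fun L M h =>
      Quotient.sound ((InvertibleSheaf.equiv_iff L M).2 h),
    fun z => (InvertibleSheaf.cechClass_surjective z).imp' (Quotient.mk _) fun _ h => h⟩

theorem picEquiv_isoClass (L : InvertibleSheaf X) : picEquiv X L.isoClass = L.cechClass := rfl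

end SemiringGeometry

/-! ### The group structure on `Pic` and the isomorphism. -/

theorem mainTheorem1 (X : SemiringGeometry.SemiringScheme.{u}) :
    -- tensor product makes the isomorphism classes of invertible sheaves an abelian group
    ∃ _ : CommGroup (SemiringGeometry.Pic X.toSemiringedSpace),
      (SemiringGeometry.InvertibleSheaf.unit X.toSemiringedSpace).isoClass = 1 ∧
      (∀ L M : SemiringGeometry.InvertibleSheaf X.toSemiringedSpace,
        (L.tensor M).isoClass = L.isoClass * M.isoClass) ∧
      -- and there is an isomorphism of groups sending a sheaf to the class of its transition
      -- functions `f_ij`, where `e_i = f_ij e_j` for the generators `e_i = φ_i(1)`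
      ∃ Φ : SemiringGeometry.Pic X.toSemiringedSpace ≃*
          SemiringGeometry.CechH1 X.toSemiringedSpace,
        ∀ (L : SemiringGeometry.InvertibleSheaf X.toSemiringedSpace)
          (𝒰 : SemiringGeometry.OpenCover X.toSemiringedSpace)
          (φ : ∀ i, SemiringGeometry.IsoOver (𝒰.set i)
            (SemiringGeometry.structureSheaf X.toSemiringedSpace).toSemimodulePresheaf
            L.1.toSemimodulePresheaf),
          ∃ f : 𝒰.Z1,
            (∀ (i j : 𝒰.ι) (hij : i < j),
              L.1.res (inf_le_left : 𝒰.set i ⊓ 𝒰.set j ≤ 𝒰.set i)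
                  ((φ i).equiv (𝒰.set i) le_rfl (1 : X.sec (𝒰.set i))) =
                (f.1 ⟨(i, j), hij⟩ : X.sec (𝒰.set i ⊓ 𝒰.set j)) •
                  L.1.res (inf_le_right : 𝒰.set i ⊓ 𝒰.set j ≤ 𝒰.set j)
                    ((φ j).equiv (𝒰.set j) le_rfl (1 : X.sec (𝒰.set j)))) ∧
            Φ L.isoClass = 𝒰.cechClass f := by
  -- The group law is pulled back along the bijection with `Ȟ¹`. That it is the tensor product with
  -- unit `𝒪_X` is then an identity of Čech classes.
  let _ : CommGroup (SemiringGeometry.Pic X.toSemiringedSpace) :=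
    (SemiringGeometry.picEquiv X.toSemiringedSpace).commGroup
  let Φ : SemiringGeometry.Pic X.toSemiringedSpace ≃*
      SemiringGeometry.CechH1 X.toSemiringedSpace :=
    (SemiringGeometry.picEquiv X.toSemiringedSpace).mulEquiv
  have hΦ : ∀ L : SemiringGeometry.InvertibleSheaf X.toSemiringedSpace,
      Φ L.isoClass = L.cechClass := fun L => SemiringGeometry.picEquiv_isoClass L
  refine ⟨inferInstance, Φ.injective ?_, fun L M => Φ.injective ?_, Φ, fun L 𝒰 φ => ?_⟩
  · rw [hΦ, map_one, SemiringGeometry.InvertibleSheaf.cechClass_unit]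
  · rw [map_mul, hΦ, hΦ, hΦ, SemiringGeometry.InvertibleSheaf.cechClass_tensor]
  · obtain ⟨f, H⟩ := SemiringGeometry.OpenCover.exists_isFrame fun i => (φ i).isGenerator
    exact ⟨⟨f, H.mem_Z1⟩, fun i j hij => H.transition ⟨(i, j), hij⟩,
      (hΦ L).trans (SemiringGeometry.InvertibleSheaf.cechClass_eq H)⟩
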